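/- Let $d\ge 1$, $\lambda>0$, $\alpha>d$ and $\tau>1$ be such that $\gamma:=\alpha(\tau-1)/d\in(1,2)$. Consider scale-free percolation on $\mathbb{Z}^d$: the vertices carry i.i.d. weights $(W_x)_{x\in\mathbb{Z}^d}$ with $\mathbb{P}(W_x\ge 1)=1$ and $\mathbb{P}(W_x>t)=\ell(t)/t^{\tau-1}$ for $t>0$, where $\ell$ varies slowly at infinity; nearest-neighbour edges are present almost surely; and, conditionally on the weights, every pair $\{x,y\}$ with $\|x-y\|>1$ is an edge, independently of the other pairs, with probability $1-\exp\{-\lambda W_xW_y/\|x-y\|^{\alpha}\}$, where $\|\cdot\|$ is the Euclidean norm. Let $d_G$ denote the graph distance, $B_n^G(0)=\{y: d_G(0,y)\le n\}$, $\Delta B_n^G(0)=\{y: d_G(0,y)=n\}$, $B_r^2(0)=\{y\in\mathbb{Z}^d:\|y\|\le r\}$ and $D_n^{\max}(0)=\max\{\|y\|: y\in\Delta B_n^G(0)\}$. Almost surely the maximum $D_n^{\max}(0)$ exists for all $n$, and the following holds. (1) For every $\varepsilon\in(0,1)$ there is a random variable $Z(\varepsilon)$ with $0<Z(\varepsilon)\le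 2$ such that, almost surely, for all $n\ge 1$, except for $n=1$ in the case that $D_1^{\max}(0)=1$, $$\exp\Big\{Z(\varepsilon)\Big(\frac{1-\varepsilon}{\gamma-1}\Big)^n\Big\}\le D_n^{\max}(0).$$ (2) There are constants $c=c(d,\alpha,\tau)>0$ and $C_\varepsilon>0$ (the latter depending on $\varepsilon$ and on the parameters of the model, including the law of the weights) such that for every $\varepsilon>0$ there is a real-valued random variable $Y(\varepsilon)$ such that, almost surely, $$D_n^{\max}(0)\le \exp\Big\{Y(\varepsilon)\Big(\frac{1+\varepsilon}{\gamma-1}\Big)^n\Big\}\ \text{ for all } n\ge 1,\qquad B_n^G(0)\subset B^2_{\exp\{Y(\varepsilon)((1+\varepsilon)/(\gamma-1))^n\}}(0)\ \text{ for all } n\ge 0,$$ and $\mathbb{P}(Y(\varepsilon)\ge K)\le C_\varepsilon\exp\{-c\,\varepsilon K\}$ for all $K\in\mathbb{R}$. -/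

import Mathlib

open MeasureTheory ProbabilityTheory Filter Topology

noncomputable section

/-- The Euclidean norm of a lattice point `x ∈ ℤ^d`. -/
def latticeNorm {d : ℕ} (x : Fin d → ℤ) : ℝ :=
  ‖(WithLp.toLp 2 (fun i => (x i : ℝ)) : EuclideanSpace ℝ (Fin d))‖

lemma latticeNorm_sub_comm {d : ℕ} (x y : Fin d → ℤ) :
    latticeNorm (x - y) = latticeNorm (y - x) := by
  simp only [latticeNorm, EuclideanSpace.norm_eq, Pi.sub_apply, Int.cast_sub, Real.norm_eq_abs,
    sq_abs]
  congr 1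
  exact Finset.sum_congr rfl fun i _ => by ring

/-- The Euclidean length `‖x - y‖` of the unordered pair `{x, y}`. -/
def edgeLength {d : ℕ} : Sym2 (Fin d → ℤ) → ℝ :=
  Sym2.lift ⟨fun x y => latticeNorm (x - y), latticeNorm_sub_comm⟩

/-- The connection probability `1 - exp (-λ w_x w_y / ‖x - y‖ ^ α)` of the unordered pair `{x, y}`,
given the vertex-weights `w`. -/
def edgeProb {d : ℕ} (α lam : ℝ) (w : (Fin d → ℤ) → ℝ) : Sym2 (Fin d → ℤ) → ℝ :=
  Sym2.lift ⟨fun x y => 1 - Real.exp (-(lam * (w x * w y / latticeNorm (x - y) ^ α))),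
    fun x y => by simp only [latticeNorm_sub_comm x y, mul_comm (w x)]⟩

/-- `ℓ` varies slowly at infinity. -/
def SlowlyVarying (ℓ : ℝ → ℝ) : Prop :=
  ∀ c : ℝ, 0 < c → Tendsto (fun t => ℓ (c * t) / ℓ t) atTop (𝓝 1)

/-- The law `ν` on `ℝ` has a power-law tail with exponent `τ`:
`ν (t, ∞) = ℓ t / t ^ (τ - 1)` for `t > 0`, with `ℓ` slowly varying at infinity. -/
def IsPowerLaw (ν : Measure ℝ) (τ : ℝ) : Prop :=
  ∃ ℓ : ℝ → ℝ, SlowlyVarying ℓ ∧ ∀ t : ℝ, 0 < t → ν.real (Set.Ioi t) = ℓ t / t ^ (τ - 1)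

/-- The random graph `G` on `ℤ^d` with vertex-weights `W`, both defined on the probability space
`(Ω, P)`, is scale-free percolation with long-range parameter `α`, percolation parameter `lam`
and weight distribution `ν`. -/
structure IsScaleFreePercolation {d : ℕ} (α lam : ℝ) (ν : Measure ℝ)
    {Ω : Type*} [MeasurableSpace Ω] (P : Measure Ω)
    (W : (Fin d → ℤ) → Ω → ℝ) (G : Ω → SimpleGraph (Fin d → ℤ)) : Prop where
  measurable_weight : ∀ x, Measurable (W x)
  measurable_adj : ∀ x y, MeasurableSet {ω | (G ω).Adj x y}
  weight_law : ∀ x, P.map (W x) = ν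
  weight_indep : iIndepFun W P
  /-- Nearest-neighbour edges are present almost surely. -/
  nearest_neighbour : ∀ x y : Fin d → ℤ, latticeNorm (x - y) = 1 → ∀ᵐ ω ∂P, (G ω).Adj x y
  /-- Conditionally on the vertex-weights, the other edges are present independently, with the
  probabilities given by `edgeProb`: for finite disjoint sets `A`, `B` of pairs of vertices at
  distance more than one, this is the conditional probability that all pairs in `A` are edges and
  no pair in `B` is. -/
  cond_edges : ∀ A B : Finset (Sym2 (Fin d → ℤ)), Disjoint A B →
    (∀ e ∈ A, 1 < edgeLength e) → (∀ e ∈ B, 1 < edgeLength e) →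
    P⟦{ω | (∀ e ∈ A, e ∈ (G ω).edgeSet) ∧ ∀ e ∈ B, e ∉ (G ω).edgeSet} |
        MeasurableSpace.comap (fun ω x => W x ω) inferInstance⟧
      =ᵐ[P] fun ω => (∏ e ∈ A, edgeProb α lam (fun x => W x ω) e) *
        ∏ e ∈ B, (1 - edgeProb α lam (fun x => W x ω) e)

/-- The Euclidean ball `{y ∈ ℤ^d : ‖x - y‖ ≤ r}`. -/
def euclideanBall {d : ℕ} (x : Fin d → ℤ) (r : ℝ) : Set (Fin d → ℤ) :=
  {y | latticeNorm (x - y) ≤ r}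

/-- The ball of radius `n` around `x` for the graph distance. -/
def graphBall {V : Type*} (G : SimpleGraph V) (x : V) (n : ℕ) : Set V :=
  {y | G.edist x y ≤ n}

/-- The sphere of radius `n` around `x` for the graph distance: the ball of radius `n` without the
ball of radius `n - 1` (which is empty for `n = 0`). -/
def graphSphere {V : Type*} (G : SimpleGraph V) (x : V) (n : ℕ) : Set V :=
  graphBall G x n \ {y | G.edist x y < n}

/-- The maximal displacement: the largest Euclidean norm of a vertex at graph distance exactly `n`
from the origin. -/
def maxDisplacement {d : ℕ} (G : SimpleGraph (Fin d → ℤ)) (n : ℕ) : ℝ :=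
  sSup (latticeNorm '' graphSphere G 0 n)

end

/-!
Write `β = d / α` and `σ = τ - 1`, so that `γ = σ / β` and `β < σ < 2 β`.

*Upper bound.* Fix `b = (1 + ε) / (γ - 1)` and caps `M_i = exp (K b ^ i)`. If a vertex at graph
distance at most `n` is too far away, then some self-avoiding path from the origin, with interior
weights `W_{x_i} ≤ M_i`, ends in its `k`-th step either in a vertex with `W > M_k` or with an edge
longer than `exp (ρ K b ^ k)` (`latticeNorm_le_of_not_hasCappedPath`). The expected number of such
paths is bounded by conditioning on the weights and using
`1 - exp (-z) ≤ min 1 z ≤ z ^ s` with `s` slightly larger than `β`, which makes the sum over the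
positions finite and leaves a product of independent functions of the weights
(`IsScaleFreePercolation.measure_exists_path_le`). Only moments of order `p < σ` of the weights
enter. An interior vertex contributes `E[W ^ (2 s); W ≤ M_i] ≤ M_i ^ (2 s - p) E[W ^ p]`, an
exceedance of the cap contributes `M_k ^ (s - p) E[W ^ p]`. Since the `M_i` grow doubly
exponentially with rate `b > 1 / (γ - 1)`, the second factor beats the product of the first ones by
`exp (-κ K b ^ k)`, where `κ b` is at least a multiple of `ε` (`exists_exponents`). For a
long last edge a larger exponent `s₀`, independent of `ε`, gives a power of the length. Summing over
`k` yields the tail of the prefactor (`exists_ball_growth_tail`).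

*Lower bound.* Let `1 < b < 1 / (γ - 1)`. For `A` strictly between `σ / d` and `(1 + 1 / b) / α`,
the box at scale `exp (A b ^ i)` contains a vertex of weight larger than `exp (b ^ i)`, and any two such
heavy vertices in consecutive boxes are joined, except with a probability summable in `i`. By
Borel-Cantelli, the heavy vertices of all large scales form a path
(`IsScaleFreePercolation.ae_exists_far_vertex`). For `b ≤ 1` the nearest-neighbour edges suffice.

*Maximal displacement.* The balls are finite by the upper bound. A nearest-neighbour path that leads
from a vertex of the ball outwards along an axis crosses the sphere, so that the maximum over the
sphere is also the maximum over the ball (`exists_mem_graphSphere`).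
-/

/-! ### The Euclidean norm on the lattice -/

section Lattice

variable {d : ℕ}

lemma latticeNorm_nonneg (x : Fin d → ℤ) : 0 ≤ latticeNorm x := norm_nonneg _

lemma latticeNorm_zero : latticeNorm (0 : Fin d → ℤ) = 0 := by
  simp [latticeNorm, EuclideanSpace.norm_eq]

lemma latticeNorm_sq (x : Fin d → ℤ) : latticeNorm x ^ 2 = ∑ i, (x i : ℝ) ^ 2 := by
  simp [latticeNorm, EuclideanSpace.norm_sq_eq]

lemma latticeNorm_neg (x : Fin d → ℤ) : latticeNorm (-x) = latticeNorm x := by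
  simpa using latticeNorm_sub_comm 0 x

lemma latticeNorm_add_le (x y : Fin d → ℤ) :
    latticeNorm (x + y) ≤ latticeNorm x + latticeNorm y := by
  have h : (WithLp.toLp 2 (fun i => ((x + y) i : ℝ)) : EuclideanSpace ℝ (Fin d)) =
      WithLp.toLp 2 (fun i => (x i : ℝ)) + WithLp.toLp 2 (fun i => (y i : ℝ)) := by
    ext i; simp
  simp only [latticeNorm, h]
  exact norm_add_le _ _

lemma abs_coord_le_latticeNorm (x : Fin d → ℤ) (i : Fin d) : |(x i : ℝ)| ≤ latticeNorm x := by
  refine abs_le_of_sq_le_sq ?_ (latticeNorm_nonneg x)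
  rw [latticeNorm_sq]
  exact Finset.single_le_sum (f := fun i => (x i : ℝ) ^ 2) (fun j _ => sq_nonneg _)
    (Finset.mem_univ i)

lemma one_le_latticeNorm {x : Fin d → ℤ} (hx : x ≠ 0) : 1 ≤ latticeNorm x := by
  obtain ⟨i, hi⟩ := Function.ne_iff.mp hx
  refine le_trans ?_ (abs_coord_le_latticeNorm x i)
  exact_mod_cast Int.one_le_abs hi

lemma latticeNorm_le_of_abs_coord_le {x : Fin d → ℤ} {B : ℝ} (hB : 0 ≤ B)
    (h : ∀ i, |(x i : ℝ)| ≤ B) : latticeNorm x ≤ d * B := by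
  have h1 : latticeNorm x ^ 2 ≤ d * B ^ 2 := by
    rw [latticeNorm_sq]
    calc ∑ i, (x i : ℝ) ^ 2 ≤ ∑ _i : Fin d, B ^ 2 :=
          Finset.sum_le_sum fun i _ => sq_le_sq' (abs_le.mp (h i)).1 (abs_le.mp (h i)).2
      _ = d * B ^ 2 := by simp
  have h2 : (d : ℝ) ≤ d ^ 2 := by exact_mod_cast Nat.le_self_pow two_ne_zero d
  refine le_of_sq_le_sq ?_ (by positivity)
  calc latticeNorm x ^ 2 ≤ d * B ^ 2 := h1
    _ ≤ d ^ 2 * B ^ 2 := by gcongr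
    _ = (d * B) ^ 2 := by ring

lemma finite_latticeNorm_le (R : ℝ) : {x : Fin d → ℤ | latticeNorm x ≤ R}.Finite := by
  refine (Set.Finite.pi' (fun _ : Fin d => Set.finite_Icc (-⌈R⌉) ⌈R⌉)).subset ?_
  intro x hx i
  have h := abs_le.mp ((abs_coord_le_latticeNorm x i).trans (le_trans hx (Int.le_ceil R)))
  exact ⟨by exact_mod_cast h.1, by exact_mod_cast h.2⟩

lemma summable_latticeNorm_rpow {r : ℝ} (hr : r < -d) :
    Summable fun x : Fin d → ℤ => latticeNorm x ^ r := by
  obtain ⟨b, hb⟩ : ∃ b : Module.Basis (Fin d) ℝ (EuclideanSpace ℝ (Fin d)),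
      ∀ v i, b.repr v i = v i :=
    ⟨(EuclideanSpace.basisFun (Fin d) ℝ).toBasis, fun v i => by simp⟩
  have hrank : Module.finrank ℤ (Submodule.span ℤ (Set.range b)) = d := by
    rw [ZLattice.rank ℝ (Submodule.span ℤ (Set.range b))]; simp
  have hs := ZLattice.summable_norm_rpow (Submodule.span ℤ (Set.range b)) r
    (by rw [hrank]; exact hr)
  have hmem : ∀ x : Fin d → ℤ, (WithLp.toLp 2 (fun i => (x i : ℝ)) : EuclideanSpace ℝ (Fin d)) ∈
      Submodule.span ℤ (Set.range b) := by
    intro x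
    rw [b.mem_span_iff_repr_mem ℤ]
    intro i
    exact ⟨x i, by simp [hb]⟩
  have hinj : Function.Injective fun x : Fin d → ℤ =>
      (⟨_, hmem x⟩ : Submodule.span ℤ (Set.range b)) := by
    intro x y h
    ext i
    have h1 := congrArg (fun v : EuclideanSpace ℝ (Fin d) => v i) (Subtype.ext_iff.mp h)
    simpa using h1
  exact (hs.comp_injective hinj).congr fun x => rfl

/-- The sum of `‖x‖ ^ (-q)` over the lattice points `x` of norm larger than `R`. -/
noncomputable def tailSum (d : ℕ) (q R : ℝ) : ENNReal :=
  ∑' x : Fin d → ℤ, if R < latticeNorm x then ENNReal.ofReal (latticeNorm x ^ (-q)) else 0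

lemma tailSum_ne_top {q : ℝ} (hq : d < q) (R : ℝ) : tailSum d q R ≠ ⊤ := by
  have h := (summable_latticeNorm_rpow (d := d) (r := -q) (by linarith)).tsum_ofReal_ne_top
  refine ne_top_of_le_ne_top h (ENNReal.tsum_le_tsum fun x => ?_)
  split_ifs <;> simp

lemma tailSum_le {q θ R : ℝ} (hθ : 0 ≤ θ) (hR : 0 < R) :
    tailSum d q R ≤ ENNReal.ofReal (R ^ (-θ)) * tailSum d (q - θ) 0 := by
  rw [tailSum, tailSum, ← ENNReal.tsum_mul_left]
  refine ENNReal.tsum_le_tsum fun x => ?_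
  by_cases h : R < latticeNorm x
  · have hx : 0 < latticeNorm x := hR.trans h
    rw [if_pos h, if_pos hx, ← ENNReal.ofReal_mul (by positivity)]
    apply ENNReal.ofReal_le_ofReal
    rw [show -q = -θ + -(q - θ) by ring, Real.rpow_add hx]
    gcongr ?_ * _
    exact Real.rpow_le_rpow_of_nonpos hR h.le (by linarith)
  · simp [h]

end Lattice

/-! ### Tails and moments of the weight distribution -/

section PowerLaw

variable {ν : Measure ℝ} {τ : ℝ}

/-- Along powers of two, slow variation gives the limiting ratio needed for the ratio test and for
eventual monotonicity. -/
lemma IsPowerLaw.tendsto_ratio (hν : IsPowerLaw ν τ) (q : ℝ) :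
    (∀ᶠ n : ℕ in atTop, (2 : ℝ) ^ (n * q) * ν.real (Set.Ioi (2 ^ n)) ≠ 0) ∧
    Tendsto (fun n : ℕ => ((2 : ℝ) ^ ((n + 1 : ℕ) * q) * ν.real (Set.Ioi (2 ^ (n + 1)))) /
      ((2 : ℝ) ^ (n * q) * ν.real (Set.Ioi (2 ^ n)))) atTop (𝓝 (2 ^ (q - (τ - 1)))) := by
  obtain ⟨ℓ, hℓ, hν⟩ := hν
  have h2 : Tendsto (fun n : ℕ => (2 : ℝ) ^ n) atTop atTop :=
    tendsto_pow_atTop_atTop_of_one_lt one_lt_two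
  have h3 := (hℓ 2 two_pos).comp h2
  have hne : ∀ᶠ n : ℕ in atTop, ℓ (2 ^ n) ≠ 0 := by
    filter_upwards [h3.eventually (lt_mem_nhds (zero_lt_one))] with n hn h0
    simp [h0] at hn
  have hpos : ∀ n : ℕ, (0 : ℝ) < 2 ^ n := fun n => by positivity
  refine ⟨?_, ?_⟩
  · filter_upwards [hne] with n hn
    rw [hν _ (hpos n)]
    have := hpos n
    positivity
  · have h4 := h3.const_mul ((2 : ℝ) ^ (q - (τ - 1)))
    rw [mul_one] at h4
    refine h4.congr' ?_
    filter_upwards [hne] with n hn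
    rw [hν _ (hpos n), hν _ (hpos (n + 1))]
    simp only [Function.comp]
    rw [← Real.rpow_natCast 2 (n + 1), ← Real.rpow_natCast 2 n, ← Real.rpow_mul two_pos.le,
      ← Real.rpow_mul two_pos.le, Real.rpow_sub two_pos,
      show (((n + 1 : ℕ) : ℝ)) * q = n * q + q by push_cast; ring,
      show (((n + 1 : ℕ) : ℝ)) * (τ - 1) = n * (τ - 1) + (τ - 1) by push_cast; ring,
      Real.rpow_add two_pos, Real.rpow_add two_pos]
    have e1 : (2 : ℝ) ^ ((n + 1 : ℕ) : ℝ) = 2 * 2 ^ (n : ℝ) := by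
      rw [Real.rpow_natCast, Real.rpow_natCast]; ring
    rw [e1]
    have e2 : ℓ (2 ^ (n : ℝ)) ≠ 0 := by rwa [Real.rpow_natCast]
    field_simp

/-- A power law with exponent `τ` has finite moments of every order below `τ - 1`. -/
lemma IsPowerLaw.lintegral_rpow_ne_top [IsProbabilityMeasure ν] (hν : IsPowerLaw ν τ)
    (h1 : ν (Set.Ici 1) = 1) {p : ℝ} (hp0 : 0 ≤ p) (hp : p < τ - 1) :
    ∫⁻ w, ENNReal.ofReal (w ^ p) ∂ν ≠ ⊤ := by
  obtain ⟨hne, ht⟩ := hν.tendsto_ratio p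
  have hsum : Summable fun n : ℕ => (2 : ℝ) ^ (n * p) * ν.real (Set.Ioi (2 ^ n)) := by
    refine summable_of_ratio_test_tendsto_lt_one
      (Real.rpow_lt_one_of_one_lt_of_neg one_lt_two (by linarith : p - (τ - 1) < 0)) hne ?_
    refine ht.congr fun n => ?_
    rw [Real.norm_of_nonneg (by positivity), Real.norm_of_nonneg (by positivity)]
  have hae : ∀ᵐ w ∂ν, (1 : ℝ) ≤ w := by
    rw [← prob_compl_eq_zero_iff measurableSet_Ici] at h1
    exact h1
  -- dyadic decomposition: `w ^ p` is at most `1` or `2 ^ p * 2 ^ (n p)` with `2 ^ n < w`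
  have hbound : ∀ᵐ w ∂ν, ENNReal.ofReal (w ^ p) ≤ 1 + ∑' n : ℕ,
      (Set.Ioi ((2 : ℝ) ^ n)).indicator (fun _ => ENNReal.ofReal (2 ^ p * 2 ^ (n * p))) w := by
    filter_upwards [hae] with w hw
    rcases hw.eq_or_lt with rfl | hw1
    · simp
    · obtain ⟨n, hn1, hn2⟩ : ∃ n : ℕ, (2 : ℝ) ^ n < w ∧ w ≤ 2 ^ (n + 1) := by
        obtain ⟨n, hn1, hn2⟩ := exists_mem_Ioc_zpow (zero_lt_one.trans hw1) (one_lt_two (α := ℝ))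
        have hn : 0 ≤ n := by
          by_contra! h
          exact absurd (hn2.trans (zpow_le_one_of_nonpos₀ one_le_two (by omega))) hw1.not_ge
        lift n to ℕ using hn
        exact ⟨n, by exact_mod_cast hn1, by exact_mod_cast hn2⟩
      refine le_trans ?_ (le_add_left (ENNReal.le_tsum n))
      rw [Set.indicator_of_mem (by exact hn1)]
      apply ENNReal.ofReal_le_ofReal
      calc w ^ p ≤ (2 ^ (n + 1)) ^ p := Real.rpow_le_rpow (by linarith) hn2 hp0
        _ = 2 ^ p * 2 ^ (n * p) := by
          rw [← Real.rpow_natCast, ← Real.rpow_mul two_pos.le, ← Real.rpow_add two_pos]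
          congr 1; push_cast; ring
  refine ne_top_of_le_ne_top ?_ (lintegral_mono_ae hbound)
  rw [lintegral_add_left measurable_const, lintegral_tsum
    (fun n => (measurable_const.indicator measurableSet_Ioi).aemeasurable)]
  refine ENNReal.add_ne_top.mpr ⟨by simp, ?_⟩
  have := (hsum.mul_left (2 ^ p)).tsum_ofReal_ne_top
  refine ne_of_eq_of_ne (tsum_congr fun n => ?_) this
  rw [lintegral_indicator_const measurableSet_Ioi, ← mul_assoc,
    ENNReal.ofReal_mul (by positivity : (0:ℝ) ≤ 2 ^ p * 2 ^ (n * p)), ofReal_measureReal]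

/-- A power law with exponent `τ` has tails heavier than `t ^ (-q)` for every `q > τ - 1`. -/
lemma IsPowerLaw.exists_tail_ge [IsProbabilityMeasure ν] (hν : IsPowerLaw ν τ)
    {q : ℝ} (hq0 : 0 ≤ q) (hq : τ - 1 < q) :
    ∃ c : ℝ, 0 < c ∧ ∀ᶠ t : ℝ in atTop, c * t ^ (-q) ≤ ν.real (Set.Ioi t) := by
  obtain ⟨hne, ht⟩ := hν.tendsto_ratio q
  set u : ℕ → ℝ := fun n => (2 : ℝ) ^ (n * q) * ν.real (Set.Ioi (2 ^ n)) with hu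
  have hu0 : ∀ n, 0 ≤ u n := fun n => by positivity
  have h1 : (1 : ℝ) < 2 ^ (q - (τ - 1)) :=
    Real.one_lt_rpow one_lt_two (by linarith)
  obtain ⟨N, hN⟩ := eventually_atTop.mp (hne.and (ht.eventually (lt_mem_nhds h1)))
  have hstep : ∀ n, N ≤ n → u N ≤ u n := by
    intro n hn
    induction n, hn using Nat.le_induction with
    | base => exact le_rfl
    | succ n hn ih =>
      have h2 := (hN n hn).2
      have h3 : 0 < u n := lt_of_le_of_ne (hu0 n) (hN n hn).1.symm
      exact ih.trans ((one_lt_div h3).mp h2).le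
  have hNpos : 0 < u N := lt_of_le_of_ne (hu0 N) (hN N le_rfl).1.symm
  refine ⟨2 ^ (-q) * u N, by positivity, ?_⟩
  filter_upwards [eventually_ge_atTop ((2 : ℝ) ^ N)] with t ht
  have ht1 : 1 ≤ t := le_trans (one_le_pow₀ one_le_two) ht
  obtain ⟨n, hn1, hn2⟩ := exists_nat_pow_near ht1 one_lt_two
  have hNn : N ≤ n + 1 := by
    by_contra! h
    exact absurd (hn2.trans_le ((pow_le_pow_right₀ one_le_two h.le).trans ht)) (lt_irrefl _)
  have h2 := hstep (n + 1) hNn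
  have h3 : ν.real (Set.Ioi (2 ^ (n + 1))) ≤ ν.real (Set.Ioi t) :=
    measureReal_mono (Set.Ioi_subset_Ioi hn2.le)
  have h4 : (0 : ℝ) < 2 ^ ((n + 1 : ℕ) * q) := by positivity
  have h5 : 2 ^ (-q) * t ^ (-q) ≤ (2 ^ ((n + 1 : ℕ) * q))⁻¹ := by
    rw [← Real.mul_rpow two_pos.le (by linarith), Real.rpow_neg (by linarith),
      Real.rpow_mul two_pos.le, Real.rpow_natCast]
    gcongr
    calc (2 : ℝ) ^ (n + 1) = 2 * 2 ^ n := by ring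
      _ ≤ 2 * t := by gcongr
  calc 2 ^ (-q) * u N * t ^ (-q) = (2 ^ (-q) * t ^ (-q)) * u N := by ring
    _ ≤ (2 ^ ((n + 1 : ℕ) * q))⁻¹ * u (n + 1) := by gcongr
    _ = ν.real (Set.Ioi (2 ^ (n + 1))) := by simp only [hu]; field_simp
    _ ≤ _ := h3

end PowerLaw

/-! ### Sums over paths -/

/-- Summing a product of edge weights over all paths of length `k` started from `0` in an abelian
group: the sum factorises by translation invariance. -/
lemma tsum_path_prod {X : Type*} [AddCommGroup X] (g : ℕ → X → ENNReal) (k : ℕ) :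
    ∑' x : Fin (k + 1) → X, ({x | x 0 = 0} : Set (Fin (k + 1) → X)).indicator
      (fun x => ∏ i : Fin k, g i (x i.succ - x i.castSucc)) x =
      ∏ i ∈ Finset.range k, ∑' z, g i z := by
  induction k with
  | zero =>
    rw [Finset.prod_range_zero, tsum_eq_single (0 : Fin 1 → X)]
    · simp
    · intro x hx
      refine Set.indicator_of_notMem (fun h => hx ?_) _
      ext i
      rw [Subsingleton.elim i 0]
      exact h
  | succ k ih =>
    rw [Finset.prod_range_succ, ← ih, ← ENNReal.tsum_mul_right,
      ← (Fin.snocEquiv fun _ : Fin (k + 2) => X).tsum_eq, ENNReal.tsum_prod', ENNReal.tsum_comm]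
    refine tsum_congr fun x => ?_
    have h : ∀ z : X, ({x | x 0 = 0} : Set (Fin (k + 2) → X)).indicator
        (fun x => ∏ i : Fin (k + 1), g i (x i.succ - x i.castSucc))
          (Fin.snocEquiv (fun _ : Fin (k + 2) => X) (z, x)) =
        ({x | x 0 = 0} : Set (Fin (k + 1) → X)).indicator
          (fun x => ∏ i : Fin k, g i (x i.succ - x i.castSucc)) x *
            g k (z - x (Fin.last k)) := by
      intro z
      have h0 : (Fin.snocEquiv (fun _ : Fin (k + 2) => X) (z, x)) 0 = x 0 := by
        have : (0 : Fin (k + 2)) = (0 : Fin (k + 1)).castSucc := rfl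
        rw [this]
        simp [Fin.snocEquiv]
      by_cases hx : x 0 = 0
      · rw [Set.indicator_of_mem (by simpa [h0] using hx), Set.indicator_of_mem (by simpa using hx),
          Fin.prod_univ_castSucc]
        congr 1
        · refine Finset.prod_congr rfl fun i _ => ?_
          change g i (Fin.snoc (α := fun _ => X) x z i.succ.castSucc -
            Fin.snoc (α := fun _ => X) x z i.castSucc.castSucc) = _
          rw [Fin.snoc_castSucc, Fin.snoc_castSucc]
        · simp [Fin.snocEquiv]
      · rw [Set.indicator_of_notMem (by simpa [h0] using hx),
          Set.indicator_of_notMem (by simpa using hx), zero_mul]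
    simp_rw [h]
    rw [ENNReal.tsum_mul_left]
    congr 1
    exact (Equiv.subRight (x (Fin.last k))).tsum_eq (g k)

section Percolation

variable {d : ℕ} {α lam : ℝ} {ν : Measure ℝ} {Ω : Type*} [MeasurableSpace Ω] {P : Measure Ω}
  {W : (Fin d → ℤ) → Ω → ℝ} {G : Ω → SimpleGraph (Fin d → ℤ)}

namespace IsScaleFreePercolation

lemma measurableSet_mem_edgeSet (h : IsScaleFreePercolation α lam ν P W G)
    (e : Sym2 (Fin d → ℤ)) : MeasurableSet {ω | e ∈ (G ω).edgeSet} := by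
  induction e with
  | _ x y => exact h.measurable_adj x y

/-- The conditional law of the edges given the weights, integrated over an event of the weights. -/
lemma measure_edges_inter [IsProbabilityMeasure P] (h : IsScaleFreePercolation α lam ν P W G)
    (A B : Finset (Sym2 (Fin d → ℤ))) (hAB : Disjoint A B) (hA : ∀ e ∈ A, 1 < edgeLength e)
    (hB : ∀ e ∈ B, 1 < edgeLength e) {S : Set ((Fin d → ℤ) → ℝ)} (hS : MeasurableSet S) :
    P ({ω | (∀ e ∈ A, e ∈ (G ω).edgeSet) ∧ ∀ e ∈ B, e ∉ (G ω).edgeSet} ∩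
      (fun ω x => W x ω) ⁻¹' S) =
      ∫⁻ ω in (fun ω x => W x ω) ⁻¹' S,
        ENNReal.ofReal ((∏ e ∈ A, edgeProb α lam (fun x => W x ω) e) *
          ∏ e ∈ B, (1 - edgeProb α lam (fun x => W x ω) e)) ∂P := by
  set E := {ω | (∀ e ∈ A, e ∈ (G ω).edgeSet) ∧ ∀ e ∈ B, e ∉ (G ω).edgeSet} with hE
  have hle : MeasurableSpace.comap (fun ω x => W x ω) inferInstance ≤ ‹MeasurableSpace Ω› :=
    (measurable_pi_iff.mpr fun x => h.measurable_weight x).comap_le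
  have hSm : MeasurableSet[MeasurableSpace.comap (fun ω x => W x ω) inferInstance]
      ((fun ω x => W x ω) ⁻¹' S) := ⟨S, hS, rfl⟩
  have hEm : MeasurableSet E := by
    have : E = (⋂ e ∈ A, {ω | e ∈ (G ω).edgeSet}) ∩ ⋂ e ∈ B, {ω | e ∈ (G ω).edgeSet}ᶜ := by
      ext ω; simp [hE]
    rw [this]
    exact (Finset.measurableSet_biInter _ fun e _ => h.measurableSet_mem_edgeSet e).inter
      (Finset.measurableSet_biInter _ fun e _ => (h.measurableSet_mem_edgeSet e).compl)
  have hae := h.cond_edges A B hAB hA hB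
  have hint : Integrable (E.indicator fun _ => (1 : ℝ)) P :=
    (integrable_const 1).indicator hEm
  have h1 := setIntegral_condExp hle hint hSm
  rw [setIntegral_indicator hEm] at h1
  simp only [integral_const, smul_eq_mul, mul_one, measureReal_restrict_apply_univ] at h1
  rw [setIntegral_congr_ae (g := fun ω => (∏ e ∈ A, edgeProb α lam (fun x => W x ω) e) *
      ∏ e ∈ B, (1 - edgeProb α lam (fun x => W x ω) e)) (hle _ hSm)
      (hae.mono fun ω hω _ => hω)] at h1
  rw [← ofReal_integral_eq_lintegral_ofReal, h1, Set.inter_comm, ofReal_measureReal]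
  · exact (integrable_condExp.congr hae).integrableOn
  · refine ae_restrict_of_ae ?_
    have h0 : 0 ≤ᵐ[P] P[E.indicator fun _ => (1 : ℝ) |
        MeasurableSpace.comap (fun ω x => W x ω) inferInstance] :=
      condExp_nonneg (ae_of_all _ fun ω => Set.indicator_nonneg (fun _ _ => zero_le_one) ω)
    filter_upwards [hae, h0] with ω h2 h3
    rw [← h2]
    exact h3

lemma ae_one_le_weight (h : IsScaleFreePercolation α lam ν P W G) (hν : ∀ᵐ w ∂ν, 1 ≤ w) :
    ∀ᵐ ω ∂P, ∀ x, 1 ≤ W x ω := by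
  refine ae_all_iff.mpr fun x => ?_
  rw [← h.weight_law x] at hν
  exact ae_of_ae_map (h.measurable_weight x).aemeasurable hν

lemma edgeProb_nonneg (hlam : 0 ≤ lam) {w : (Fin d → ℤ) → ℝ} (hw : ∀ x, 1 ≤ w x)
    (x y : Fin d → ℤ) : 0 ≤ edgeProb α lam w s(x, y) := by
  have h1 := latticeNorm_nonneg (x - y)
  have hx := zero_le_one.trans (hw x)
  have hy := zero_le_one.trans (hw y)
  have : 0 ≤ lam * (w x * w y / latticeNorm (x - y) ^ α) := by positivity
  simp only [edgeProb, Sym2.lift_mk]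
  linarith [Real.exp_le_one_iff.mpr (neg_nonpos.mpr this)]

/-- The interpolation `1 - exp (-z) ≤ min 1 z ≤ z ^ s` for the connection probability. -/
lemma edgeProb_le (hlam : 0 ≤ lam) {w : (Fin d → ℤ) → ℝ} (hw : ∀ x, 1 ≤ w x)
    {x y : Fin d → ℤ} (hxy : x ≠ y) {s : ℝ} (hs0 : 0 ≤ s) (hs1 : s ≤ 1) :
    edgeProb α lam w s(x, y) ≤
      max lam 1 ^ s * latticeNorm (y - x) ^ (-(α * s)) * (w x * w y) ^ s := by
  have h1 : 0 < latticeNorm (y - x) :=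
    zero_lt_one.trans_le (one_le_latticeNorm (sub_ne_zero.mpr hxy.symm))
  have hx := zero_le_one.trans (hw x)
  have hy := zero_le_one.trans (hw y)
  simp only [edgeProb, Sym2.lift_mk, latticeNorm_sub_comm x y]
  set z := lam * (w x * w y / latticeNorm (y - x) ^ α) with hz
  have hz0 : 0 ≤ z := by positivity
  have hb : (max lam 1 * (w x * w y / latticeNorm (y - x) ^ α)) ^ s =
      max lam 1 ^ s * latticeNorm (y - x) ^ (-(α * s)) * (w x * w y) ^ s := by
    rw [Real.mul_rpow (by positivity) (by positivity), Real.div_rpow (by positivity)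
      (by positivity), ← Real.rpow_mul h1.le, Real.rpow_neg h1.le]
    field_simp
  rw [← hb]
  have hzs : z ^ s ≤ (max lam 1 * (w x * w y / latticeNorm (y - x) ^ α)) ^ s := by
    apply Real.rpow_le_rpow hz0 _ hs0
    rw [hz]
    gcongr
    exact le_max_left _ _
  refine le_trans ?_ hzs
  have he : 1 - Real.exp (-z) ≤ z := by linarith [Real.add_one_le_exp (-z)]
  rcases le_total z 1 with h | h
  · exact he.trans (Real.self_le_rpow_of_le_one hz0 h hs1)
  · exact (by linarith [Real.exp_pos (-z)] : 1 - Real.exp (-z) ≤ 1).trans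
      (Real.one_le_rpow h hs0)

/-- The probability that a given self-avoiding path is present, with restrictions on the weights
along it. The weights of the edges incident to a vertex are collected at that vertex, and the
weights of distinct vertices are independent. -/
lemma measure_path_le [IsProbabilityMeasure P] (h : IsScaleFreePercolation α lam ν P W G)
    (hν : ∀ᵐ w ∂ν, 1 ≤ w) (hlam : 0 ≤ lam) {k : ℕ} {x : Fin (k + 1) → Fin d → ℤ}
    (hx : Function.Injective x) {S : ℕ → Set ℝ} (hS : ∀ i, MeasurableSet (S i)) {s : ℕ → ℝ}
    (hs0 : ∀ i, 0 ≤ s i) (hs1 : ∀ i, s i ≤ 1) (hsz : s 0 = 0) (hsl : s (k + 1) = 0) :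
    P {ω | (∀ i : Fin k, (G ω).Adj (x i.castSucc) (x i.succ)) ∧
        ∀ i : Fin (k + 1), W (x i) ω ∈ S i} ≤
      (∏ i : Fin k, ENNReal.ofReal (max lam 1 ^ s (i + 1) *
        latticeNorm (x i.succ - x i.castSucc) ^ (-(α * s (i + 1))))) *
      ∏ i ∈ Finset.range (k + 1), ∫⁻ w in S i, ENNReal.ofReal (w ^ (s i + s (i + 1))) ∂ν := by
  classical
  have hne : ∀ i : Fin k, x i.castSucc ≠ x i.succ := fun i hi =>
    (Fin.castSucc_lt_succ (i := i)).ne (hx hi)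
  set I : Finset (Fin k) := Finset.univ.filter fun i =>
    1 < latticeNorm (x i.castSucc - x i.succ) with hI
  have hinj : Function.Injective fun i : Fin k => s(x i.castSucc, x i.succ) := by
    intro i j hij
    rcases Sym2.eq_iff.mp hij with ⟨h1, -⟩ | ⟨h1, h2⟩
    · exact Fin.castSucc_injective _ (hx h1)
    · have h1 := congrArg Fin.val (hx h1)
      have h2 := congrArg Fin.val (hx h2)
      simp at h1 h2
      omega
  -- the conditional law is prescribed for the edges longer than one only
  set A : Finset (Sym2 (Fin d → ℤ)) := I.image fun i => s(x i.castSucc, x i.succ) with hA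
  set T : Set ((Fin d → ℤ) → ℝ) := {w | ∀ i : Fin (k + 1), w (x i) ∈ S i} with hT
  have hTm : MeasurableSet T := by
    have : T = ⋂ i : Fin (k + 1), (fun w => w (x i)) ⁻¹' S i := by ext w; simp [hT]
    rw [this]
    exact MeasurableSet.iInter fun i => measurable_pi_apply _ (hS i)
  have hWm : Measurable fun ω x => W x ω := measurable_pi_iff.mpr h.measurable_weight
  have hAlen : ∀ e ∈ A, 1 < edgeLength e := by
    intro e he
    obtain ⟨i, hi, rfl⟩ := Finset.mem_image.mp he
    exact (Finset.mem_filter.mp hi).2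
  have key := h.measure_edges_inter A ∅ (by simp) hAlen (by simp) hTm
  simp only [Finset.prod_empty, mul_one] at key
  have hsub : {ω | (∀ i : Fin k, (G ω).Adj (x i.castSucc) (x i.succ)) ∧
        ∀ i : Fin (k + 1), W (x i) ω ∈ S i} ⊆
      {ω | (∀ e ∈ A, e ∈ (G ω).edgeSet) ∧ ∀ e ∈ (∅ : Finset (Sym2 (Fin d → ℤ))),
        e ∉ (G ω).edgeSet} ∩ (fun ω x => W x ω) ⁻¹' T := by
    rintro ω ⟨h1, h2⟩
    refine ⟨⟨fun e he => ?_, by simp⟩, h2⟩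
    obtain ⟨i, -, rfl⟩ := Finset.mem_image.mp he
    exact h1 i
  refine (measure_mono hsub).trans (key.le.trans ?_)
  set c : Fin k → ℝ := fun i => max lam 1 ^ s (i + 1) *
        latticeNorm (x i.succ - x i.castSucc) ^ (-(α * s (i + 1))) with hc
  have hc0 : ∀ i, 0 ≤ c i := fun i => by
    have := latticeNorm_nonneg (x i.succ - x i.castSucc)
    positivity
  -- pointwise bound on the conditional probability of the path
  have hpt : ∀ w : (Fin d → ℤ) → ℝ, (∀ x, 1 ≤ w x) → ∏ e ∈ A, edgeProb α lam w e ≤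
      (∏ i, c i) * ∏ i : Fin (k + 1), w (x i) ^ (s i + s (i + 1)) := by
    intro w hw
    have hw0 : ∀ x, 0 < w x := fun x => zero_lt_one.trans_le (hw x)
    have e1 : ∏ i : Fin (k + 1), w (x i) ^ (s i + s (i + 1)) =
        ∏ i : Fin k, (w (x i.castSucc) * w (x i.succ)) ^ s (i + 1) := by
      simp_rw [Real.rpow_add (hw0 _), Finset.prod_mul_distrib]
      rw [Fin.prod_univ_succ, Fin.prod_univ_castSucc (fun i => w (x i) ^ s (i + 1))]
      simp only [Fin.val_zero, hsz, Fin.val_last, hsl, Real.rpow_zero, one_mul, mul_one,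
        Fin.val_succ, Fin.val_castSucc]
      rw [← Finset.prod_mul_distrib]
      refine Finset.prod_congr rfl fun i _ => ?_
      rw [mul_comm, ← Real.mul_rpow (hw0 _).le (hw0 _).le]
    rw [e1, ← Finset.prod_mul_distrib, hA, Finset.prod_image (hinj.injOn), hI,
      Finset.prod_filter]
    refine Finset.prod_le_prod (fun i _ => ?_) fun i _ => ?_
    · split_ifs
      · exact edgeProb_nonneg hlam hw _ _
      · exact zero_le_one
    · split_ifs with hlen
      · exact edgeProb_le hlam hw (hne i) (hs0 _) (hs1 _)
      · -- a pair at distance one: the bound is at least `1`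
        have h1 : latticeNorm (x i.succ - x i.castSucc) = 1 := by
          refine le_antisymm ?_ (one_le_latticeNorm (sub_ne_zero.mpr (hne i).symm))
          rw [latticeNorm_sub_comm]
          exact not_lt.mp hlen
        simp only [hc, h1, Real.one_rpow, mul_one]
        rw [← Real.mul_rpow (by positivity) (mul_pos (hw0 _) (hw0 _)).le]
        refine Real.one_le_rpow ?_ (hs0 _)
        exact one_le_mul_of_one_le_of_one_le (le_max_right _ _)
          (one_le_mul_of_one_le_of_one_le (hw _) (hw _))
  rw [← lintegral_indicator (hWm hTm)]
  let f : ℕ → ℝ → ENNReal := fun i =>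
    (S i).indicator fun w => ENNReal.ofReal (w ^ (s i + s (i + 1)))
  have hf : ∀ i, Measurable (f i) := fun i =>
    (ENNReal.measurable_ofReal.comp (measurable_id.pow_const _)).indicator (hS i)
  have hmain : ∫⁻ ω, ((fun ω x => W x ω) ⁻¹' T).indicator
        (fun ω => ENNReal.ofReal (∏ e ∈ A, edgeProb α lam (fun x => W x ω) e)) ω ∂P ≤
      ∫⁻ ω, (∏ i, ENNReal.ofReal (c i)) * ∏ i : Fin (k + 1), f i (W (x i) ω) ∂P := by
    refine lintegral_mono_ae ?_
    filter_upwards [h.ae_one_le_weight hν] with ω hω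
    by_cases hωT : ω ∈ (fun ω x => W x ω) ⁻¹' T
    · rw [Set.indicator_of_mem hωT]
      have : ∀ i : Fin (k + 1), f i (W (x i) ω) = ENNReal.ofReal (W (x i) ω ^ (s i + s (i + 1))) :=
        fun i => Set.indicator_of_mem (hωT i) _
      simp_rw [this]
      rw [← ENNReal.ofReal_prod_of_nonneg (fun i _ => hc0 i), ← ENNReal.ofReal_prod_of_nonneg
        (fun i _ => Real.rpow_nonneg (zero_le_one.trans (hω _)) _), ← ENNReal.ofReal_mul
        (Finset.prod_nonneg fun i _ => hc0 i)]
      exact ENNReal.ofReal_le_ofReal (hpt _ hω)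
    · rw [Set.indicator_of_notMem hωT]
      exact zero_le
  refine hmain.trans ?_
  rw [lintegral_const_mul' _ _ (ENNReal.prod_ne_top fun i _ => ENNReal.ofReal_ne_top)]
  refine mul_le_mul_right (le_of_eq ?_) _
  have hind : iIndepFun (fun (i : Fin (k + 1)) ω => f i (W (x i) ω)) P :=
    (h.weight_indep.precomp hx).comp (fun i => f i) fun i => hf i
  rw [lintegral_prod_eq_prod_lintegral_of_indepFun Finset.univ _ hind
    fun i => (hf i).comp (h.measurable_weight _), ← Fin.prod_univ_eq_prod_range
    (fun i => ∫⁻ w in S i, ENNReal.ofReal (w ^ (s i + s (i + 1))) ∂ν)]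
  refine Finset.prod_congr rfl fun i _ => ?_
  rw [← lintegral_map (hf i) (h.measurable_weight _), h.weight_law, lintegral_indicator (hS i)]

/-- First-moment bound for the existence of a self-avoiding path of length `k` from the origin
with prescribed ranges for its weights and lower bounds for its edge lengths. -/
lemma measure_exists_path_le [IsProbabilityMeasure P] (h : IsScaleFreePercolation α lam ν P W G)
    (hν : ∀ᵐ w ∂ν, 1 ≤ w) (hlam : 0 ≤ lam) (k : ℕ) {S : ℕ → Set ℝ}
    (hS : ∀ i, MeasurableSet (S i)) {s : ℕ → ℝ} (hs0 : ∀ i, 0 ≤ s i) (hs1 : ∀ i, s i ≤ 1)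
    (hsz : s 0 = 0) (hsl : s (k + 1) = 0) (r : ℕ → ℝ) :
    P {ω | ∃ x : Fin (k + 1) → Fin d → ℤ, Function.Injective x ∧ x 0 = 0 ∧
        (∀ i : Fin k, (G ω).Adj (x i.castSucc) (x i.succ)) ∧
        (∀ i : Fin k, r (i + 1) < latticeNorm (x i.succ - x i.castSucc)) ∧
        ∀ i : Fin (k + 1), W (x i) ω ∈ S i} ≤
      (∏ i ∈ Finset.range k,
        ENNReal.ofReal (max lam 1 ^ s (i + 1)) * tailSum d (α * s (i + 1)) (r (i + 1))) *
      ∏ i ∈ Finset.range (k + 1), ∫⁻ w in S i, ENNReal.ofReal (w ^ (s i + s (i + 1))) ∂ν := by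
  set g : ℕ → (Fin d → ℤ) → ENNReal := fun i z => if r (i + 1) < latticeNorm z then
    ENNReal.ofReal (max lam 1 ^ s (i + 1)) *
      ENNReal.ofReal (latticeNorm z ^ (-(α * s (i + 1)))) else 0 with hg
  have hgsum : ∀ i, ∑' z, g i z =
      ENNReal.ofReal (max lam 1 ^ s (i + 1)) * tailSum d (α * s (i + 1)) (r (i + 1)) := by
    intro i
    rw [tailSum, ← ENNReal.tsum_mul_left]
    refine tsum_congr fun z => ?_
    simp only [hg]
    split_ifs <;> simp
  simp_rw [← hgsum]
  rw [← tsum_path_prod, ← ENNReal.tsum_mul_right]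
  simp only [Set.ofPred_exists]
  refine (measure_iUnion_le _).trans (ENNReal.tsum_le_tsum fun x => ?_)
  by_cases hx : Function.Injective x ∧ x 0 = 0 ∧
      ∀ i : Fin k, r (i + 1) < latticeNorm (x i.succ - x i.castSucc)
  · rw [Set.indicator_of_mem (by exact hx.2.1)]
    refine le_trans (measure_mono ?_) ((h.measure_path_le hν hlam hx.1 hS hs0 hs1 hsz hsl).trans
      (le_of_eq ?_))
    · rintro ω ⟨-, -, h1, -, h2⟩
      exact ⟨h1, h2⟩
    · congr 1
      refine Finset.prod_congr rfl fun i _ => ?_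
      simp only [hg]
      rw [if_pos (hx.2.2 i), ENNReal.ofReal_mul (by positivity)]
  · refine le_trans (le_of_eq ?_) zero_le
    convert measure_empty (μ := P)
    ext ω
    simp only [Set.mem_ofPred_eq, Set.mem_empty_iff_false, iff_false]
    rintro ⟨h1, h2, -, h3, -⟩
    exact hx ⟨h1, h2, h3⟩

end IsScaleFreePercolation

end Percolation

/-! ### Doubly exponential series -/

lemma summable_pow_mul_exp_neg_pow {C κ b : ℝ} (hC : 0 < C) (hκ : 0 < κ) (hb : 1 < b) :
    Summable fun n : ℕ => C ^ n * Real.exp (-(κ * b ^ n)) := by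
  refine summable_of_ratio_test_tendsto_lt_one zero_lt_one
    (Eventually.of_forall fun n => by positivity) ?_
  have h1 : Tendsto (fun n : ℕ => κ * (b - 1) * b ^ n) atTop atTop :=
    (tendsto_pow_atTop_atTop_of_one_lt hb).const_mul_atTop (mul_pos hκ (by linarith))
  have h2 := (Real.tendsto_exp_neg_atTop_nhds_zero.comp h1).const_mul C
  rw [mul_zero] at h2
  refine h2.congr fun n => ?_
  rw [Real.norm_of_nonneg (by positivity), Real.norm_of_nonneg (by positivity)]
  have h3 : Real.exp (-(κ * b ^ (n + 1))) =
      Real.exp (-(κ * b ^ n)) * Real.exp (-(κ * (b - 1) * b ^ n)) := by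
    rw [← Real.exp_add]; congr 1; ring
  rw [h3, Function.comp_apply, pow_succ]
  field_simp

lemma sum_pow_succ_le {b : ℝ} (hb : 1 < b) (n : ℕ) :
    ∑ i ∈ Finset.range n, b ^ (i + 1) ≤ b ^ (n + 1) / (b - 1) := by
  have hb1 : 0 < b - 1 := by linarith
  simp_rw [pow_succ]
  rw [← Finset.sum_mul, geom_sum_eq hb.ne', div_mul_eq_mul_div]
  gcongr
  nlinarith

/-! ### Choice of the exponents -/

/-- With `β = d / α` and `σ = τ - 1`, the exponents `s` and `p` are taken close to `β` and `σ`.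
For `s = β` and `p = σ` the decay rate `p - s - (2 * s - p) / (b - 1)` equals
`(σ - β) ε β / (2 β - σ + ε β)`, which is at least `ε β / b`; half of it is kept. -/
lemma exists_exponents {β σ s₀ ε b : ℝ} (hβ : 0 < β) (hβσ : β < σ) (hσ : σ < 2 * β)
    (hs₀ : β < s₀) (hs₀σ : s₀ < σ) (hε : 0 < ε) (hb : b = (1 + ε) * β / (σ - β)) :
    ∃ s p : ℝ, β < s ∧ s ≤ s₀ ∧ s₀ ≤ p ∧ p < σ ∧ p ≤ 2 * s ∧
      0 < p - s - (2 * s - p) / (b - 1) ∧ p - s - (2 * s - p) / (b - 1) ≤ σ ∧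
      ε * β / 2 ≤ (p - s - (2 * s - p) / (b - 1)) * b := by
  have h1 : 0 < σ - β := by linarith
  have hb0 : 0 < b := by rw [hb]; positivity
  have hb1 : b - 1 = (2 * β - σ + ε * β) / (σ - β) := by rw [hb]; field_simp; ring
  have h2 : 0 < 2 * β - σ + ε * β := by nlinarith
  have hb2 : 0 < b - 1 := by rw [hb1]; positivity
  set κ₀ := σ - β - (2 * β - σ) / (b - 1) with hκ₀
  have hκ₀' : κ₀ = (σ - β) * (ε * β) / (2 * β - σ + ε * β) := by
    rw [hκ₀, hb1, div_div_eq_mul_div, eq_div_iff h2.ne', sub_mul, div_mul_cancel₀ _ h2.ne']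
    ring
  have hκ₀pos : 0 < κ₀ := by rw [hκ₀']; positivity
  have hκ₀b : ε * β ≤ κ₀ * b := by
    rw [hκ₀', hb]
    have e : (σ - β) * (ε * β) / (2 * β - σ + ε * β) * ((1 + ε) * β / (σ - β)) =
        ε * β * ((1 + ε) * β / (2 * β - σ + ε * β)) := by field_simp
    rw [e]
    refine le_mul_of_one_le_right (by positivity) ((one_le_div h2).mpr (by nlinarith))
  set D := 2 + 3 / (b - 1) with hD
  have hDpos : 0 < D := by positivity
  -- moving `s` and `p` by `η` lowers the rate by `η * D`
  set η := min (s₀ - β) (min (σ - s₀) (κ₀ / (2 * D))) with hη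
  have hη0 : 0 < η := lt_min (by linarith) (lt_min (by linarith) (by positivity))
  have hη1 : η ≤ s₀ - β := min_le_left _ _
  have hη2 : η ≤ σ - s₀ := (min_le_right _ _).trans (min_le_left _ _)
  have hη3 : η * D ≤ κ₀ / 2 := by
    have : η ≤ κ₀ / (2 * D) := (min_le_right _ _).trans (min_le_right _ _)
    calc η * D ≤ κ₀ / (2 * D) * D := by gcongr
      _ = κ₀ / 2 := by field_simp
  have hκ : σ - η - (β + η) - (2 * (β + η) - (σ - η)) / (b - 1) = κ₀ - η * D := by
    rw [hκ₀, hD]; field_simp; ring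
  refine ⟨β + η, σ - η, by linarith, by linarith, by linarith, by linarith, by linarith, ?_, ?_, ?_⟩
  · rw [hκ]; linarith
  · have : 0 ≤ (2 * (β + η) - (σ - η)) / (b - 1) := div_nonneg (by linarith) hb2.le
    linarith
  · rw [hκ]
    calc ε * β / 2 ≤ κ₀ * b / 2 := by linarith
      _ = κ₀ / 2 * b := by ring
      _ ≤ (κ₀ - η * D) * b := by gcongr; linarith

/-! ### Truncated moments -/

section Moments

variable {ν : Measure ℝ}

lemma lintegral_rpow_mono (hν : ∀ᵐ w ∂ν, 1 ≤ w) {t p : ℝ} (htp : t ≤ p) (S : Set ℝ) :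
    ∫⁻ w in S, ENNReal.ofReal (w ^ t) ∂ν ≤ ∫⁻ w, ENNReal.ofReal (w ^ p) ∂ν := by
  refine (lintegral_mono' Measure.restrict_le_self le_rfl).trans (lintegral_mono_ae ?_)
  filter_upwards [hν] with w hw
  exact ENNReal.ofReal_le_ofReal (Real.rpow_le_rpow_of_exponent_le hw htp)

/-- Truncated moments above and below the critical order: `w ^ t ≤ M ^ (t - p) w ^ p` holds on the
set `S` when `S` lies below `M` and `p ≤ t`, or above `M` and `t ≤ p`. -/
lemma lintegral_rpow_le_of_subset (hν : ∀ᵐ w ∂ν, 1 ≤ w) {t p M : ℝ} (hM : 0 < M) {S : Set ℝ}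
    (hS : MeasurableSet S) (h : (S ⊆ Set.Iic M ∧ p ≤ t) ∨ (S ⊆ Set.Ioi M ∧ t ≤ p)) :
    ∫⁻ w in S, ENNReal.ofReal (w ^ t) ∂ν ≤
      ENNReal.ofReal (M ^ (t - p)) * ∫⁻ w, ENNReal.ofReal (w ^ p) ∂ν := by
  rw [← lintegral_const_mul' _ _ ENNReal.ofReal_ne_top]
  refine le_trans ?_ (lintegral_mono' (μ := ν.restrict S) Measure.restrict_le_self le_rfl)
  refine lintegral_mono_ae ?_
  filter_upwards [ae_restrict_of_ae hν, ae_restrict_mem hS] with w hw hwS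
  have hw0 : 0 < w := by linarith
  rw [← ENNReal.ofReal_mul (by positivity)]
  apply ENNReal.ofReal_le_ofReal
  calc w ^ t = w ^ (t - p) * w ^ p := by rw [← Real.rpow_add hw0]; congr 1; ring
    _ ≤ M ^ (t - p) * w ^ p := by
      gcongr ?_ * _
      rcases h with ⟨h1, h2⟩ | ⟨h1, h2⟩
      · exact Real.rpow_le_rpow hw0.le (h1 hwS) (by linarith)
      · exact Real.rpow_le_rpow_of_nonpos hM (le_of_lt (h1 hwS)) (by linarith)

end Moments

/-! ### Exploration paths -/

section Exploration

variable {d : ℕ}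

/-- There is a self-avoiding path `x 0 = 0, …, x (n + 1)` of length `n + 1` whose interior weights
obey the caps `w (x i) ≤ M i`, whose last edge is longer than `R` and whose last weight is
in `L`. -/
def HasCappedPath (g : SimpleGraph (Fin d → ℤ)) (w : (Fin d → ℤ) → ℝ) (M : ℕ → ℝ) (L : Set ℝ)
    (R : ℝ) (n : ℕ) : Prop :=
  ∃ x : Fin (n + 2) → Fin d → ℤ, Function.Injective x ∧ x 0 = 0 ∧
    (∀ i : Fin (n + 1), g.Adj (x i.castSucc) (x i.succ)) ∧
    R < latticeNorm (x (Fin.last n).succ - x (Fin.last n).castSucc) ∧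
    (∀ i : Fin (n + 2), i ≠ 0 → i ≠ Fin.last (n + 1) → w (x i) ≤ M i) ∧ w (x (Fin.last (n + 1))) ∈ L

/-- If no capped path ends in a vertex violating its cap or in an edge violating its length bound,
then the graph ball of radius `m` lies in the Euclidean ball of radius `m * R m`. -/
lemma latticeNorm_le_of_not_hasCappedPath {g : SimpleGraph (Fin d → ℤ)} {w : (Fin d → ℤ) → ℝ}
    {M R : ℕ → ℝ} (hR : Monotone R) (hR0 : ∀ m, 0 ≤ R m)
    (h1 : ∀ n, ¬ HasCappedPath g w M (Set.Ioi (M (n + 1))) 0 n)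
    (h2 : ∀ n, ¬ HasCappedPath g w M Set.univ (R (n + 1)) n) {y : Fin d → ℤ} {m : ℕ}
    (hy : g.edist 0 y ≤ m) : latticeNorm y ≤ m * R m := by
  classical
  obtain ⟨q, hq⟩ := SimpleGraph.exists_walk_of_edist_ne_top
    (ne_top_of_le_ne_top (ENat.natCast_ne_top m) hy)
  have hqm : q.length ≤ m := by rw [← hq] at hy; exact_mod_cast hy
  obtain ⟨p, hp, hpm⟩ : ∃ p : g.Walk 0 y, p.IsPath ∧ p.length ≤ m :=
    ⟨q.bypass, q.bypass_isPath, q.length_bypass_le_length.trans hqm⟩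
  have hprefix : ∀ n, n + 1 ≤ p.length → (∀ i, 1 ≤ i → i ≤ n → w (p.getVert i) ≤ M i) →
      w (p.getVert (n + 1)) ≤ M (n + 1) ∧
        latticeNorm (p.getVert (n + 1) - p.getVert n) ≤ R (n + 1) := by
    intro n hn hcap
    have hinj : Function.Injective fun i : Fin (n + 2) => p.getVert i := by
      intro i j hij
      have := hp.getVert_injOn (by simp; omega) (by simp; omega) hij
      exact Fin.ext this
    have hadj : ∀ i : Fin (n + 1), g.Adj (p.getVert i.castSucc) (p.getVert i.succ) := fun i => by
      simpa using p.adj_getVert_succ (i := i) (by omega)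
    have hcap' : ∀ i : Fin (n + 2), i ≠ 0 → i ≠ Fin.last (n + 1) → w (p.getVert i) ≤ M i := by
      intro i hi hl
      have hi' : (i : ℕ) ≠ 0 := fun h => hi (Fin.ext h)
      have hl' : (i : ℕ) ≠ n + 1 := fun h => hl (Fin.ext h)
      exact hcap i (by omega) (by omega)
    constructor
    · by_contra! hlt
      refine h1 n ⟨fun i => p.getVert i, hinj, by simp, hadj, ?_, hcap', by simpa using hlt⟩
      exact zero_lt_one.trans_le (one_le_latticeNorm (sub_ne_zero.mpr (hadj (Fin.last n)).ne.symm))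
    · by_contra! hlt
      exact h2 n ⟨fun i => p.getVert i, hinj, by simp, hadj, by simpa using hlt, hcap', trivial⟩
  have hcaps : ∀ n, n ≤ p.length → ∀ i, 1 ≤ i → i ≤ n → w (p.getVert i) ≤ M i := by
    intro n
    induction n with
    | zero => intro _ i h h'; omega
    | succ n ih =>
      intro hn i hi hin
      rcases Nat.lt_or_ge i (n + 1) with h | h
      · exact ih (by omega) i hi (by omega)
      · obtain rfl : i = n + 1 := by omega
        exact (hprefix n hn (ih (by omega))).1
  have hnorm : ∀ n, n ≤ p.length → latticeNorm (p.getVert n) ≤ n * R m := by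
    intro n
    induction n with
    | zero => intro _; simp [latticeNorm_zero]
    | succ n ih =>
      intro hn
      have h3 := latticeNorm_add_le (p.getVert (n + 1) - p.getVert n) (p.getVert n)
      rw [sub_add_cancel] at h3
      have h4 := (hprefix n hn (hcaps n (by omega))).2.trans (hR (by omega : n + 1 ≤ m))
      have h5 := ih (by omega)
      push_cast
      linarith
  have h6 := hnorm _ le_rfl
  rw [p.getVert_length] at h6
  exact h6.trans (mul_le_mul_of_nonneg_right (by exact_mod_cast hpm) (hR0 m))

end Exploration

section Percolation

variable {d : ℕ} {α lam : ℝ} {ν : Measure ℝ} {Ω : Type*} [MeasurableSpace Ω] {P : Measure Ω}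
  {W : (Fin d → ℤ) → Ω → ℝ} {G : Ω → SimpleGraph (Fin d → ℤ)}

namespace IsScaleFreePercolation

/-- First-moment bound for capped paths: every edge but the last is estimated with the exponent
`s`, the last one with the exponent `s'`. -/
lemma measure_hasCappedPath_le [IsProbabilityMeasure P]
    (h : IsScaleFreePercolation α lam ν P W G) (hν : ∀ᵐ w ∂ν, 1 ≤ w) (hlam : 0 ≤ lam) (n : ℕ)
    {M : ℕ → ℝ} {L : Set ℝ} (hL : MeasurableSet L) {R s s' : ℝ} (hs0 : 0 ≤ s) (hs1 : s ≤ 1)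
    (hs'0 : 0 ≤ s') (hs'1 : s' ≤ 1) {D D' I J : ENNReal} {B : ℕ → ENNReal}
    (hD : ENNReal.ofReal (max lam 1 ^ s) * tailSum d (α * s) 0 ≤ D)
    (hD' : ENNReal.ofReal (max lam 1 ^ s') * tailSum d (α * s') R ≤ D')
    (hI : ∀ t, t = s ∨ t = s' → ∫⁻ w, ENNReal.ofReal (w ^ t) ∂ν ≤ I)
    (hB : ∀ i, ∀ t, t = s ∨ t = s' →
      ∫⁻ w in Set.Iic (M (i + 1)), ENNReal.ofReal (w ^ (s + t)) ∂ν ≤ B i)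
    (hJ : ∫⁻ w in L, ENNReal.ofReal (w ^ s') ∂ν ≤ J) :
    P {ω | HasCappedPath (G ω) (fun x => W x ω) M L R n} ≤
      D ^ n * D' * ((∏ i ∈ Finset.range n, B i) * I * J) := by
  let σ : ℕ → ℝ := fun i => if i = 0 then 0 else if i ≤ n then s else if i = n + 1 then s' else 0
  let S : ℕ → Set ℝ := fun i => if i = 0 then Set.univ else if i ≤ n then Set.Iic (M i) else L
  let r : ℕ → ℝ := fun i => if i ≤ n then 0 else R
  have key := h.measure_exists_path_le hν hlam (n + 1) (S := S) (s := σ)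
    (fun i => by dsimp only [S]; split_ifs <;> measurability)
    (fun i => by dsimp only [σ]; split_ifs <;> simp [*])
    (fun i => by dsimp only [σ]; split_ifs <;> simp [*])
    (by simp [σ]) (by simp [σ]) r
  refine (measure_mono ?_).trans (key.trans (mul_le_mul' ?_ ?_))
  · rintro ω ⟨x, hinj, hx0, hadj, hlen, hcap, hlast⟩
    refine ⟨x, hinj, hx0, hadj, fun i => ?_, fun i => ?_⟩
    · induction i using Fin.lastCases with
      | last => simpa [r] using hlen
      | cast i =>
        have : r ((i.castSucc : ℕ) + 1) = 0 := if_pos (by simp)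
        rw [this]
        exact zero_lt_one.trans_le (one_le_latticeNorm (sub_ne_zero.mpr (hadj _).ne.symm))
    · by_cases hi0 : i = 0
      · simp [S, hi0]
      · have hi0' : (i : ℕ) ≠ 0 := fun h => hi0 (Fin.ext h)
        by_cases hil : i = Fin.last (n + 1)
        · subst hil
          simpa [S] using hlast
        · have hil' : (i : ℕ) ≠ n + 1 := fun h => hil (Fin.ext h)
          have : (i : ℕ) ≤ n := by omega
          simpa [S, hi0', this] using hcap i hi0 hil
  · rw [Finset.prod_range_succ]
    refine mul_le_mul' ?_ ?_
    · refine (Finset.prod_le_pow_card _ _ D fun i hi => ?_).trans (by simp)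
      have : i + 1 ≤ n := by simp at hi; omega
      simpa [σ, r, this] using hD
    · simpa [σ, r] using hD'
  · rw [Finset.prod_range_succ, Finset.prod_range_succ']
    refine mul_le_mul' (mul_le_mul' (Finset.prod_le_prod' fun i hi => ?_) ?_) ?_
    · have hi' : i + 1 ≤ n := by simp at hi; omega
      have e1 : S (i + 1) = Set.Iic (M (i + 1)) := by simp [S, hi']
      have e2 : σ (i + 1) = s := by simp [σ, hi']
      rw [e1, e2]
      refine hB i _ ?_
      by_cases h3 : i + 2 ≤ n
      · left; simp [σ, h3]
      · right
        obtain rfl : n = i + 1 := by omega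
        simp [σ]
    · have e1 : S 0 = Set.univ := by simp [S]
      have e2 : σ 0 = 0 := by simp [σ]
      rw [e1, e2, Measure.restrict_univ]
      simp only [zero_add]
      refine hI _ ?_
      by_cases h3 : 1 ≤ n
      · left; simp [σ, h3]
      · right
        obtain rfl : n = 0 := by omega
        simp [σ]
    · simpa [S, σ] using hJ

end IsScaleFreePercolation

end Percolation

/-! ### Growth of balls: the upper bound -/

section Percolation

variable {d : ℕ} {α lam : ℝ} {ν : Measure ℝ} {Ω : Type*} [MeasurableSpace Ω] {P : Measure Ω}
  {W : (Fin d → ℤ) → Ω → ℝ} {G : Ω → SimpleGraph (Fin d → ℤ)}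

namespace IsScaleFreePercolation

/-- A capped path whose last weight exceeds its cap: the interior vertices contribute truncated
moments of order `2 s`, the last vertex the tail of the moment of order `s`. -/
lemma measure_hasCappedPath_Ioi_le [IsProbabilityMeasure P]
    (h : IsScaleFreePercolation α lam ν P W G) (hν : ∀ᵐ w ∂ν, 1 ≤ w) (hlam : 0 ≤ lam) (n : ℕ)
    {s p b K : ℝ} (hs0 : 0 ≤ s) (hs1 : s ≤ 1) (hsp : s ≤ p) (hps : p ≤ 2 * s) (hb : 1 < b)
    (hK : 0 ≤ K) {D I : ENNReal}
    (hD : ENNReal.ofReal (max lam 1 ^ s) * tailSum d (α * s) 0 ≤ D)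
    (hI : ∫⁻ w, ENNReal.ofReal (w ^ p) ∂ν ≤ I) :
    P {ω | HasCappedPath (G ω) (fun x => W x ω) (fun i => Real.exp (K * b ^ i))
        (Set.Ioi (Real.exp (K * b ^ (n + 1)))) 0 n} ≤
      D ^ (n + 1) * I ^ (n + 2) *
        ENNReal.ofReal (Real.exp (-((p - s - (2 * s - p) / (b - 1)) * (K * b ^ (n + 1))))) := by
  have h2 : ∀ M : ℝ, 0 < M → ∫⁻ w in Set.Iic M, ENNReal.ofReal (w ^ (s + s)) ∂ν ≤
      ENNReal.ofReal (M ^ (s + s - p)) * I := fun M hM =>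
    (lintegral_rpow_le_of_subset (t := s + s) (p := p) hν hM measurableSet_Iic
      (Or.inl ⟨le_rfl, by linarith⟩)).trans (by gcongr)
  have key := h.measure_hasCappedPath_le hν hlam n (M := fun i => Real.exp (K * b ^ i))
    (L := Set.Ioi (Real.exp (K * b ^ (n + 1)))) measurableSet_Ioi (R := 0) (s' := s) (I := I)
    (B := fun i => ENNReal.ofReal (Real.exp (K * b ^ (i + 1)) ^ (s + s - p)) * I)
    hs0 hs1 hs0 hs1 hD hD
    (fun t ht => by
      rw [or_self] at ht
      rw [ht, ← setLIntegral_univ]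
      exact (lintegral_rpow_mono hν hsp Set.univ).trans hI)
    (fun i t ht => by
      rw [or_self] at ht
      rw [ht]
      exact h2 _ (Real.exp_pos _))
    (lintegral_rpow_le_of_subset hν (Real.exp_pos _) measurableSet_Ioi (Or.inr ⟨le_rfl, hsp⟩))
  refine key.trans ?_
  have e1 : ∏ i ∈ Finset.range n, ENNReal.ofReal (Real.exp (K * b ^ (i + 1)) ^ (s + s - p)) * I =
      ENNReal.ofReal (Real.exp ((s + s - p) * (K * ∑ i ∈ Finset.range n, b ^ (i + 1)))) * I ^ n := by
    rw [Finset.prod_mul_distrib, Finset.prod_const, Finset.card_range,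
      ← ENNReal.ofReal_prod_of_nonneg (fun i _ => by positivity), Finset.mul_sum, Finset.mul_sum,
      Real.exp_sum]
    congr 2
    refine Finset.prod_congr rfl fun i _ => ?_
    rw [← Real.exp_mul, mul_comm]
  have e2 : ENNReal.ofReal (Real.exp ((s + s - p) * (K * ∑ i ∈ Finset.range n, b ^ (i + 1)))) *
        ENNReal.ofReal (Real.exp (K * b ^ (n + 1)) ^ (s - p)) ≤
      ENNReal.ofReal (Real.exp (-((p - s - (2 * s - p) / (b - 1)) * (K * b ^ (n + 1))))) := by
    rw [← ENNReal.ofReal_mul (Real.exp_pos _).le, ← Real.exp_mul, ← Real.exp_add]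
    apply ENNReal.ofReal_le_ofReal
    apply Real.exp_le_exp.mpr
    have h3 : (s + s - p) * (K * ∑ i ∈ Finset.range n, b ^ (i + 1)) ≤
        (s + s - p) * (K * (b ^ (n + 1) / (b - 1))) := by
      have : 0 ≤ s + s - p := by linarith
      gcongr
      exact sum_pow_succ_le hb n
    have h4 : -((p - s - (2 * s - p) / (b - 1)) * (K * b ^ (n + 1))) =
        (s + s - p) * (K * (b ^ (n + 1) / (b - 1))) + K * b ^ (n + 1) * (s - p) := by ring
    rw [h4]
    gcongr
  rw [e1]
  calc _ = D ^ (n + 1) * (I ^ (n + 1) * ∫⁻ w, ENNReal.ofReal (w ^ p) ∂ν) *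
        (ENNReal.ofReal (Real.exp ((s + s - p) * (K * ∑ i ∈ Finset.range n, b ^ (i + 1)))) *
        ENNReal.ofReal (Real.exp (K * b ^ (n + 1)) ^ (s - p))) := by ring
    _ ≤ D ^ (n + 1) * (I ^ (n + 1) * I) * ENNReal.ofReal
        (Real.exp (-((p - s - (2 * s - p) / (b - 1)) * (K * b ^ (n + 1))))) :=
        mul_le_mul' (mul_le_mul_right (mul_le_mul_right hI _) _) e2
    _ = _ := by rw [← pow_succ]

/-- A capped path whose last edge is very long: with the exponent `s₀ > d / α` for the last edge,
its length contributes a negative power that beats the crude bound `M ^ 2` for the weights. -/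
lemma measure_hasCappedPath_univ_le [IsProbabilityMeasure P]
    (h : IsScaleFreePercolation α lam ν P W G) (hν : ∀ᵐ w ∂ν, 1 ≤ w) (hlam : 0 ≤ lam) (n : ℕ)
    {s s₀ p b K θ ρ : ℝ} (hs0 : 0 ≤ s) (hs : s ≤ s₀) (hs₀1 : s₀ ≤ 1) (hs₀p : s₀ ≤ p)
    (hb : 1 < b) (hK : 0 ≤ K) (hθ : 0 ≤ θ) {D I : ENNReal} (hI1 : 1 ≤ I)
    (hD : ENNReal.ofReal (max lam 1 ^ s) * tailSum d (α * s) 0 ≤ D)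
    (hD' : ENNReal.ofReal (max lam 1 ^ s₀) * tailSum d (α * s₀ - θ) 0 ≤ D)
    (hI : ∫⁻ w, ENNReal.ofReal (w ^ p) ∂ν ≤ I) (hνI : ν Set.univ ≤ 1) :
    P {ω | HasCappedPath (G ω) (fun x => W x ω) (fun i => Real.exp (K * b ^ i))
        Set.univ (Real.exp (ρ * (K * b ^ (n + 1)))) n} ≤
      D ^ (n + 1) * I ^ (n + 2) *
        ENNReal.ofReal (Real.exp (-((ρ * θ - 2 / (b - 1)) * (K * b ^ (n + 1))))) := by
  have hp : ∀ t, t = s ∨ t = s₀ → ∫⁻ w, ENNReal.ofReal (w ^ t) ∂ν ≤ I := by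
    intro t ht
    rw [← setLIntegral_univ]
    refine (lintegral_rpow_mono hν ?_ Set.univ).trans hI
    rcases ht with rfl | rfl <;> linarith
  have h2 : ∀ M : ℝ, 1 ≤ M → ∀ t, t = s ∨ t = s₀ →
      ∫⁻ w in Set.Iic M, ENNReal.ofReal (w ^ (s + t)) ∂ν ≤ ENNReal.ofReal (M ^ (2 : ℝ)) := by
    intro M hM t ht
    have hst : 0 ≤ s + t ∧ s + t ≤ 2 := by rcases ht with rfl | rfl <;> constructor <;> linarith
    have h3 := lintegral_rpow_le_of_subset hν (t := s + t) (p := 0) (zero_lt_one.trans_le hM)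
      measurableSet_Iic (Or.inl ⟨le_rfl, hst.1⟩)
    refine h3.trans ?_
    simp only [Real.rpow_zero, ENNReal.ofReal_one, lintegral_one, sub_zero]
    refine (mul_le_of_le_one_right' hνI).trans (ENNReal.ofReal_le_ofReal ?_)
    exact Real.rpow_le_rpow_of_exponent_le hM hst.2
  have key := h.measure_hasCappedPath_le hν hlam n (M := fun i => Real.exp (K * b ^ i))
    (L := Set.univ) MeasurableSet.univ (R := Real.exp (ρ * (K * b ^ (n + 1)))) (s' := s₀) (I := I)
    (D' := ENNReal.ofReal (Real.exp (ρ * (K * b ^ (n + 1))) ^ (-θ)) * D)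
    (B := fun i => ENNReal.ofReal (Real.exp (K * b ^ (i + 1)) ^ (2 : ℝ)))
    hs0 (hs.trans hs₀1) (hs0.trans hs) hs₀1 hD
    (by
      refine le_trans ?_ (mul_le_mul_right hD' _)
      rw [mul_left_comm (ENNReal.ofReal (_ ^ (-θ)))]
      exact mul_le_mul_right (tailSum_le hθ (Real.exp_pos _)) _)
    hp (fun i t ht => h2 _ (Real.one_le_exp (by positivity)) t ht)
    (J := I) (by rw [setLIntegral_univ]; exact hp s₀ (Or.inr rfl))
  refine key.trans ?_
  have e1 : ∏ i ∈ Finset.range n, ENNReal.ofReal (Real.exp (K * b ^ (i + 1)) ^ (2 : ℝ)) =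
      ENNReal.ofReal (Real.exp (2 * (K * ∑ i ∈ Finset.range n, b ^ (i + 1)))) := by
    rw [← ENNReal.ofReal_prod_of_nonneg (fun i _ => by positivity), Finset.mul_sum, Finset.mul_sum,
      Real.exp_sum]
    congr 1
    refine Finset.prod_congr rfl fun i _ => ?_
    rw [← Real.exp_mul, mul_comm]
  have e2 : ENNReal.ofReal (Real.exp (2 * (K * ∑ i ∈ Finset.range n, b ^ (i + 1)))) *
        ENNReal.ofReal (Real.exp (ρ * (K * b ^ (n + 1))) ^ (-θ)) ≤
      ENNReal.ofReal (Real.exp (-((ρ * θ - 2 / (b - 1)) * (K * b ^ (n + 1))))) := by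
    rw [← ENNReal.ofReal_mul (Real.exp_pos _).le, ← Real.exp_mul, ← Real.exp_add]
    apply ENNReal.ofReal_le_ofReal
    apply Real.exp_le_exp.mpr
    have h3 : 2 * (K * ∑ i ∈ Finset.range n, b ^ (i + 1)) ≤
        2 * (K * (b ^ (n + 1) / (b - 1))) := by
      gcongr
      exact sum_pow_succ_le hb n
    have h4 : -((ρ * θ - 2 / (b - 1)) * (K * b ^ (n + 1))) =
        2 * (K * (b ^ (n + 1) / (b - 1))) + ρ * (K * b ^ (n + 1)) * (-θ) := by ring
    rw [h4]
    gcongr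
  rw [e1]
  calc _ = D ^ (n + 1) * I ^ 2 *
        (ENNReal.ofReal (Real.exp (2 * (K * ∑ i ∈ Finset.range n, b ^ (i + 1)))) *
        ENNReal.ofReal (Real.exp (ρ * (K * b ^ (n + 1))) ^ (-θ))) := by ring
    _ ≤ _ := mul_le_mul' (mul_le_mul_right (pow_le_pow_right₀ hI1 (by omega)) _) e2

end IsScaleFreePercolation

/-- The tail bound behind the upper bound on the growth of balls. The constants `c` and `A` depend
on `d`, `α`, `τ` only, because the margin in the length of the last edge of a path does not degrade
as `ε` tends to zero. -/
lemma exists_ball_growth_tail (d : ℕ) (hd : 1 ≤ d) (α τ γ : ℝ) (hα : (d : ℝ) < α)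
    (hγ : γ = α * (τ - 1) / d) (hγ1 : 1 < γ) (hγ2 : γ < 2) :
    ∃ c A : ℝ, 0 < c ∧ 0 < A ∧ ∀ (lam : ℝ) (ν : Measure ℝ) [IsProbabilityMeasure ν],
      0 < lam → IsPowerLaw ν τ → ν (Set.Ici 1) = 1 → ∀ ε : ℝ, 0 < ε → ∃ C : ℝ, 0 < C ∧
      ∀ {Ω : Type*} [MeasurableSpace Ω] (P : Measure Ω) [IsProbabilityMeasure P]
        (W : (Fin d → ℤ) → Ω → ℝ) (G : Ω → SimpleGraph (Fin d → ℤ)),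
        IsScaleFreePercolation α lam ν P W G → ∀ K : ℝ, 1 ≤ K →
        P {ω | ¬ ∀ n : ℕ, ∀ y ∈ graphBall (G ω) 0 n,
          latticeNorm y ≤ Real.exp (A * K * ((1 + ε) / (γ - 1)) ^ n)} ≤
        ENNReal.ofReal (C * Real.exp (-(c * ε * K))) := by
  have hd0 : (0 : ℝ) < d := by exact_mod_cast hd
  have hα0 : 0 < α := hd0.trans hα
  set β := (d : ℝ) / α with hβ
  set σ := τ - 1 with hσ
  have hγ' : γ = σ / β := by rw [hγ, hβ]; field_simp
  have hβ0 : 0 < β := by positivity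
  have hβ1 : β < 1 := (div_lt_one hα0).mpr hα
  have hβσ : β < σ := by rw [hγ'] at hγ1; exact (one_lt_div hβ0).mp hγ1
  have hσ2 : σ < 2 * β := by rw [hγ'] at hγ2; exact (div_lt_iff₀ hβ0).mp hγ2
  -- `s₀ > β` makes the tail sums of the edge lengths a negative power, `s₀ < σ` keeps the moments
  obtain ⟨s₀, hs₀, hs₀'⟩ := exists_between (lt_min hβσ hβ1)
  have hs₀σ : s₀ < σ := hs₀'.trans_le (min_le_left _ _)
  have hs₀1 : s₀ < 1 := hs₀'.trans_le (min_le_right _ _)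
  have hαβ : α * β = d := by rw [hβ]; field_simp
  set θ := (α * s₀ - d) / 2 with hθ
  have hθ0 : 0 < θ := by
    have : α * β < α * s₀ := by gcongr
    rw [hθ]; linarith
  have hγ1' : 0 < γ - 1 := by linarith
  set b₀ := 1 / (γ - 1) with hb₀
  have hb₀1 : 1 < b₀ := by rw [hb₀, one_lt_div hγ1']; linarith
  have hb₀' : 0 < b₀ - 1 := by linarith
  -- the length of the last edge has to beat the weights, which cost at most the rate
  -- `2 / (b₀ - 1)`, and to leave the rate `σ`; as `b₀` is the rate for `ε = 0`, this is uniform in `ε`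
  set ρ := (2 / (b₀ - 1) + σ) / θ with hρ
  have hσ0 : 0 < σ := hβ0.trans hβσ
  have hρ0 : 0 < ρ := by positivity
  refine ⟨β / 2, ρ + 1 / (b₀ - 1), by positivity, by positivity, ?_⟩
  intro lam ν _ hlam hpow hν1 ε hε
  have hν : ∀ᵐ w ∂ν, (1 : ℝ) ≤ w := by
    rw [← prob_compl_eq_zero_iff measurableSet_Ici] at hν1
    exact hν1
  set b := (1 + ε) / (γ - 1) with hb
  have hbb₀ : b₀ ≤ b := by rw [hb, hb₀]; gcongr; linarith
  have hb1 : 1 < b := hb₀1.trans_le hbb₀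
  have hb1' : 0 < b - 1 := by linarith
  obtain ⟨s, p, hs, hss₀, hs₀p, hpσ, hps, hκ0, hκσ, hκb⟩ := exists_exponents hβ0 hβσ hσ2 hs₀ hs₀σ hε
    (b := b) (by rw [hb, hγ']; field_simp)
  set κ := p - s - (2 * s - p) / (b - 1) with hκ
  have hs0 : 0 < s := hβ0.trans hs
  set D : ENNReal := ENNReal.ofReal (max lam 1 ^ s) * tailSum d (α * s) 0 +
    ENNReal.ofReal (max lam 1 ^ s₀) * tailSum d (α * s₀ - θ) 0 with hD
  set I : ENNReal := ∫⁻ w, ENNReal.ofReal (w ^ p) ∂ν + 1 with hI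
  have hαs : (d : ℝ) < α * s := by rw [← hαβ]; gcongr
  have hDtop : D ≠ ⊤ := ENNReal.add_ne_top.mpr
    ⟨ENNReal.mul_ne_top ENNReal.ofReal_ne_top (tailSum_ne_top hαs 0),
      ENNReal.mul_ne_top ENNReal.ofReal_ne_top (tailSum_ne_top (by rw [hθ]; linarith) 0)⟩
  have hItop : I ≠ ⊤ := ENNReal.add_ne_top.mpr
    ⟨hpow.lintegral_rpow_ne_top hν1 (by linarith) hpσ, ENNReal.one_ne_top⟩
  have hI1 : 1 ≤ I := le_add_self
  set E : ℝ := D.toReal * I.toReal ^ 2 + 1 with hE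
  have hE0 : 0 < E := by positivity
  have hDI : ∀ n : ℕ, D ^ (n + 1) * I ^ (n + 2) ≤ ENNReal.ofReal (E ^ (n + 1)) := by
    intro n
    calc D ^ (n + 1) * I ^ (n + 2) ≤ D ^ (n + 1) * I ^ (2 * (n + 1)) := by
          gcongr
          · omega
      _ = (D * I ^ 2) ^ (n + 1) := by rw [mul_pow, ← pow_mul]
      _ ≤ (ENNReal.ofReal E) ^ (n + 1) := by
          gcongr
          rw [← ENNReal.ofReal_toReal hDtop, ← ENNReal.ofReal_toReal hItop,
            ← ENNReal.ofReal_pow ENNReal.toReal_nonneg, ← ENNReal.ofReal_mul ENNReal.toReal_nonneg]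
          exact ENNReal.ofReal_le_ofReal (by rw [hE]; linarith)
      _ = _ := by rw [← ENNReal.ofReal_pow hE0.le]
  set a : ℕ → ℝ := fun n => E ^ (n + 1) * Real.exp (-(κ * b ^ (n + 1))) with ha
  have hasum : Summable a :=
    (summable_nat_add_iff (f := fun n => E ^ n * Real.exp (-(κ * b ^ n))) 1).mpr
      (summable_pow_mul_exp_neg_pow hE0 hκ0 hb1)
  have ha0 : ∀ n, 0 ≤ a n := fun n => by positivity
  have hA0 : 0 ≤ ∑' n, a n := tsum_nonneg ha0
  refine ⟨2 * Real.exp (κ * b) * (∑' n, a n + 1),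
    by positivity, ?_⟩
  intro Ω _ P _ W G h K hK
  have hK0 : 0 ≤ K := by linarith
  have hsub : {ω | ¬ ∀ n : ℕ, ∀ y ∈ graphBall (G ω) 0 n,
        latticeNorm y ≤ Real.exp ((ρ + 1 / (b₀ - 1)) * K * b ^ n)} ⊆
      ⋃ n : ℕ, ({ω | HasCappedPath (G ω) (fun x => W x ω) (fun i => Real.exp (K * b ^ i))
        (Set.Ioi (Real.exp (K * b ^ (n + 1)))) 0 n} ∪
        {ω | HasCappedPath (G ω) (fun x => W x ω) (fun i => Real.exp (K * b ^ i))
        Set.univ (Real.exp (ρ * (K * b ^ (n + 1)))) n}) := by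
    intro ω hω
    by_contra hcon
    simp only [Set.mem_iUnion, Set.mem_union, Set.mem_ofPred_eq, not_exists, not_or] at hcon
    refine hω fun n y hy => ?_
    have hmono : Monotone fun n : ℕ => Real.exp (ρ * (K * b ^ n)) := by
      intro m n hmn
      have := pow_le_pow_right₀ hb1.le hmn
      dsimp only
      gcongr
    have h1 := latticeNorm_le_of_not_hasCappedPath hmono (fun _ => (Real.exp_pos _).le)
      (fun n => (hcon n).1) (fun n => (hcon n).2) hy
    -- the number of steps is absorbed into the exponent, by Bernoulli's inequality for `b₀ ^ n`
    have hn : (n : ℝ) ≤ Real.exp (1 / (b₀ - 1) * (K * b ^ n)) := by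
      have h2 : 1 + (n : ℝ) * (b₀ - 1) ≤ b₀ ^ n := by
        have := one_add_mul_le_pow (a := b₀ - 1) (by linarith) n
        simpa using this
      have h3 : b₀ ^ n ≤ b ^ n := by gcongr
      have h4 : b ^ n ≤ K * b ^ n := le_mul_of_one_le_left (by positivity) hK
      have h5 : (n : ℝ) ≤ 1 / (b₀ - 1) * (K * b ^ n) := by
        rw [one_div, inv_mul_eq_div, le_div_iff₀ hb₀']
        linarith
      linarith [Real.add_one_le_exp (1 / (b₀ - 1) * (K * b ^ n))]
    calc latticeNorm y ≤ n * Real.exp (ρ * (K * b ^ n)) := h1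
      _ ≤ Real.exp (1 / (b₀ - 1) * (K * b ^ n)) * Real.exp (ρ * (K * b ^ n)) := by gcongr
      _ = _ := by rw [← Real.exp_add]; congr 1; ring
  have hexp : ∀ n : ℕ, ∀ κ' : ℝ, κ ≤ κ' → D ^ (n + 1) * I ^ (n + 2) *
      ENNReal.ofReal (Real.exp (-(κ' * (K * b ^ (n + 1))))) ≤
      ENNReal.ofReal (Real.exp (κ * b) * Real.exp (-(κ * b * K)) * a n) := by
    intro n κ' hκ'
    refine (mul_le_mul_left (hDI n) _).trans ?_
    rw [← ENNReal.ofReal_mul (by positivity)]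
    apply ENNReal.ofReal_le_ofReal
    have h1 : Real.exp (-(κ' * (K * b ^ (n + 1)))) ≤
        Real.exp (κ * b) * Real.exp (-(κ * b * K)) * Real.exp (-(κ * b ^ (n + 1))) := by
      rw [← Real.exp_add, ← Real.exp_add]
      apply Real.exp_le_exp.mpr
      have h2 : κ * (K * b ^ (n + 1)) ≤ κ' * (K * b ^ (n + 1)) := by gcongr
      have h3 : b ≤ b ^ (n + 1) := le_self_pow₀ hb1.le (by omega)
      have h4 : 0 ≤ κ * ((K - 1) * (b ^ (n + 1) - b)) :=
        mul_nonneg hκ0.le (mul_nonneg (by linarith) (by linarith))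
      nlinarith
    calc E ^ (n + 1) * Real.exp (-(κ' * (K * b ^ (n + 1)))) ≤ E ^ (n + 1) *
          (Real.exp (κ * b) * Real.exp (-(κ * b * K)) * Real.exp (-(κ * b ^ (n + 1)))) := by gcongr
      _ = _ := by rw [ha]; ring
  have hρκ : κ ≤ ρ * θ - 2 / (b - 1) := by
    have h1 : ρ * θ = 2 / (b₀ - 1) + σ := by rw [hρ]; field_simp
    have h2 : 2 / (b - 1) ≤ 2 / (b₀ - 1) := by gcongr
    linarith
  calc P _ ≤ ∑' n : ℕ, ENNReal.ofReal (2 * (Real.exp (κ * b) * Real.exp (-(κ * b * K)) * a n)) := by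
        refine (measure_mono hsub).trans ((measure_iUnion_le _).trans
          (ENNReal.tsum_le_tsum fun n => (measure_union_le _ _).trans ?_))
        rw [two_mul, ENNReal.ofReal_add (by positivity) (by positivity)]
        refine add_le_add ((h.measure_hasCappedPath_Ioi_le hν hlam.le n hs0.le (by linarith)
          (by linarith) hps hb1 hK0 (D := D) (I := I) le_self_add le_self_add).trans
            (hexp n _ le_rfl)) ?_
        exact (h.measure_hasCappedPath_univ_le hν hlam.le n hs0.le hss₀ hs₀1.le hs₀p hb1 hK0 hθ0.le
          (D := D) (I := I) hI1 le_self_add le_add_self le_self_add prob_le_one).trans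
            (hexp n _ hρκ)
    _ = ENNReal.ofReal (2 * (Real.exp (κ * b) * Real.exp (-(κ * b * K)) * ∑' n, a n)) := by
        rw [← ENNReal.ofReal_tsum_of_nonneg (fun n => by positivity)
          ((hasum.mul_left _).mul_left 2), tsum_mul_left, tsum_mul_left]
    _ ≤ _ := by
        apply ENNReal.ofReal_le_ofReal
        have h1 : Real.exp (-(κ * b * K)) ≤ Real.exp (-(β / 2 * ε * K)) := by
          apply Real.exp_le_exp.mpr
          have := mul_le_mul_of_nonneg_right hκb hK0
          linarith
        calc 2 * (Real.exp (κ * b) * Real.exp (-(κ * b * K)) * ∑' n, a n)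
            ≤ 2 * (Real.exp (κ * b) * Real.exp (-(β / 2 * ε * K)) * (∑' n, a n + 1)) := by
              gcongr
              exact le_add_of_nonneg_right zero_le_one
          _ = 2 * Real.exp (κ * b) * (∑' n, a n + 1) * Real.exp (-(β / 2 * ε * K)) := by ring

end Percolation

/-! ### Graphs containing the nearest-neighbour lattice -/

section Graph

variable {d : ℕ} {g : SimpleGraph (Fin d → ℤ)}

lemma latticeNorm_single (i : Fin d) (t : ℤ) :
    latticeNorm (Pi.single i t : Fin d → ℤ) = |(t : ℝ)| := by
  rw [← abs_of_nonneg (latticeNorm_nonneg _), ← sq_eq_sq_iff_abs_eq_abs, latticeNorm_sq,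
    Finset.sum_eq_single i]
  · simp
  · intro j _ hj; simp [hj]
  · simp

lemma adj_add_single (hg : ∀ x y, latticeNorm (x - y) = 1 → g.Adj x y) (x : Fin d → ℤ) (i : Fin d)
    {t : ℤ} (ht : |t| = 1) : g.Adj x (x + Pi.single i t) := by
  apply hg
  rw [latticeNorm_sub_comm, add_sub_cancel_left, latticeNorm_single]
  exact_mod_cast ht

lemma reachable_of_nearest_neighbour (hg : ∀ x y, latticeNorm (x - y) = 1 → g.Adj x y)
    (y : Fin d → ℤ) : g.Reachable 0 y := by
  have h1 : ∀ (x : Fin d → ℤ) (i : Fin d) (t : ℤ), g.Reachable x (x + Pi.single i t) := by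
    intro x i t
    induction t with
    | zero => simp
    | succ n ih =>
      rw [Pi.single_add, ← add_assoc]
      exact ih.trans (adj_add_single hg _ i (by simp)).reachable
    | pred n ih =>
      rw [sub_eq_add_neg, Pi.single_add, ← add_assoc]
      exact ih.trans (adj_add_single hg _ i (by simp)).reachable
  rw [← Finset.univ_sum_single y]
  generalize (Finset.univ : Finset (Fin d)) = s
  classical
  induction s using Finset.induction_on with
  | empty => simp
  | insert i s hi ih =>
    rw [Finset.sum_insert hi, add_comm]
    exact ih.trans (h1 _ _ _)

lemma edist_le_add_one_of_adj {u v w : Fin d → ℤ} (h : g.Adj v w) :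
    g.edist u w ≤ g.edist u v + 1 := by
  rw [← SimpleGraph.edist_eq_one_iff_adj.mpr h]
  exact SimpleGraph.edist_triangle

/-- Walking away from the origin along a coordinate axis, starting in the ball of radius `n`, the
graph distance grows by at most one per step and is unbounded, so that the sphere of radius `n` is
met in a vertex of no smaller norm. -/
lemma exists_mem_graphSphere (hd : 1 ≤ d) (hg : ∀ x y, latticeNorm (x - y) = 1 → g.Adj x y) {n : ℕ}
    {R : ℝ} (hR : ∀ y ∈ graphBall g 0 n, latticeNorm y ≤ R) {y : Fin d → ℤ}
    (hy : y ∈ graphBall g 0 n) : ∃ z ∈ graphSphere g 0 n, latticeNorm y ≤ latticeNorm z := by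
  classical
  let i : Fin d := ⟨0, hd⟩
  obtain ⟨δ, hδ, hyδ⟩ : ∃ δ : ℤ, |δ| = 1 ∧ 0 ≤ y i * δ := by
    rcases le_total 0 (y i) with h | h
    · exact ⟨1, by simp, by simpa using h⟩
    · exact ⟨-1, by simp, by simpa using h⟩
  let z : ℕ → Fin d → ℤ := fun t => y + Pi.single i (t * δ)
  have hδ2 : (δ : ℝ) ^ 2 = 1 := by
    have : δ ^ 2 = 1 := by rw [← sq_abs, hδ]; rfl
    exact_mod_cast this
  have hyδ' : (0 : ℝ) ≤ y i * δ := by exact_mod_cast hyδ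
  have hz : ∀ t, latticeNorm (z t) ^ 2 = latticeNorm y ^ 2 + (2 * t * (y i * δ) + t ^ 2) := by
    intro t
    rw [latticeNorm_sq, latticeNorm_sq, ← Finset.add_sum_erase _ _ (Finset.mem_univ i),
      ← Finset.add_sum_erase _ (fun j => (y j : ℝ) ^ 2) (Finset.mem_univ i)]
    have h1 : ∑ j ∈ Finset.univ.erase i, (z t j : ℝ) ^ 2 =
        ∑ j ∈ Finset.univ.erase i, (y j : ℝ) ^ 2 :=
      Finset.sum_congr rfl fun j hj => by simp [z, Finset.ne_of_mem_erase hj]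
    rw [h1]
    simp only [z, Pi.add_apply, Pi.single_eq_same]
    push_cast
    linear_combination (t : ℝ) ^ 2 * hδ2
  have hzy : ∀ t, latticeNorm y ≤ latticeNorm (z t) := fun t => by
    refine le_of_sq_le_sq ?_ (latticeNorm_nonneg _)
    rw [hz]
    have : 0 ≤ 2 * t * (y i * δ : ℝ) + t ^ 2 := by positivity
    linarith
  have hstep : ∀ t, g.Adj (z t) (z (t + 1)) := fun t => by
    have : z (t + 1) = z t + Pi.single i δ := by
      simp only [z]
      rw [add_assoc, ← Pi.single_add]
      congr 2
      push_cast; ring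
    rw [this]
    exact adj_add_single hg _ _ hδ
  have hex : ∃ t, z t ∉ graphBall g 0 n := by
    obtain ⟨t, ht⟩ := exists_nat_gt R
    refine ⟨t, fun hmem => ?_⟩
    have h1 := hR _ hmem
    have h2 : (t : ℝ) ≤ latticeNorm (z t) := by
      refine le_of_sq_le_sq ?_ (latticeNorm_nonneg _)
      rw [hz]
      have : 0 ≤ latticeNorm y ^ 2 + 2 * t * (y i * δ : ℝ) := by positivity
      linarith
    linarith
  have hmin := Nat.find_spec hex
  obtain ⟨t, ht⟩ : ∃ t, Nat.find hex = t + 1 := by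
    refine Nat.exists_eq_succ_of_ne_zero fun h0 => ?_
    rw [h0] at hmin
    exact hmin (by simpa [z] using hy)
  have hmem : z t ∈ graphBall g 0 n := not_not.mp (Nat.find_min hex (by omega))
  rw [ht] at hmin
  refine ⟨z t, ⟨hmem, fun hlt => hmin ?_⟩, hzy t⟩
  have hlt' : g.edist 0 (z t) < n := hlt
  exact (edist_le_add_one_of_adj (hstep t)).trans (Order.add_one_le_of_lt hlt')

lemma zero_mem_graphBall (n : ℕ) : (0 : Fin d → ℤ) ∈ graphBall g 0 n := by
  simp [graphBall]

lemma isGreatest_maxDisplacement (hd : 1 ≤ d) (hg : ∀ x y, latticeNorm (x - y) = 1 → g.Adj x y)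
    {n : ℕ} {R : ℝ} (hR : ∀ y ∈ graphBall g 0 n, latticeNorm y ≤ R) :
    IsGreatest (latticeNorm '' graphSphere g 0 n) (maxDisplacement g n) := by
  have hfin : (latticeNorm '' graphSphere g 0 n).Finite :=
    ((finite_latticeNorm_le R).subset fun y hy => hR y hy.1).image _
  obtain ⟨z, hz, -⟩ := exists_mem_graphSphere hd hg hR (zero_mem_graphBall n)
  have hne : (latticeNorm '' graphSphere g 0 n).Nonempty := ⟨_, z, hz, rfl⟩
  exact ⟨hne.csSup_mem hfin, fun _ h => le_csSup hfin.bddAbove h⟩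

/-- The maximal displacement is also the largest norm in the graph ball. -/
lemma le_maxDisplacement (hd : 1 ≤ d) (hg : ∀ x y, latticeNorm (x - y) = 1 → g.Adj x y)
    {n : ℕ} {R : ℝ} (hR : ∀ y ∈ graphBall g 0 n, latticeNorm y ≤ R) {y : Fin d → ℤ}
    (hy : y ∈ graphBall g 0 n) : latticeNorm y ≤ maxDisplacement g n := by
  obtain ⟨z, hz, hyz⟩ := exists_mem_graphSphere hd hg hR hy
  exact hyz.trans ((isGreatest_maxDisplacement hd hg hR).2 ⟨z, hz, rfl⟩)

lemma mem_graphBall_succ_iff (n : ℕ) (y : Fin d → ℤ) :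
    y ∈ graphBall g 0 (n + 1) ↔ ∃ z ∈ graphBall g 0 n, z = y ∨ g.Adj z y := by
  constructor
  · intro hy
    have hy' : g.edist 0 y ≤ ((n + 1 : ℕ) : ℕ∞) := hy
    rcases hy'.lt_or_eq with h | h
    · refine ⟨y, ?_, Or.inl rfl⟩
      have h : g.edist 0 y < (n : ℕ∞) + 1 := by exact_mod_cast h
      exact Order.le_of_lt_add_one h
    · obtain ⟨p, hp⟩ := SimpleGraph.exists_walk_of_edist_eq_coe h
      refine ⟨p.getVert n, ?_, Or.inr ?_⟩
      · have h1 := SimpleGraph.edist_le (p.take n)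
        refine h1.trans ?_
        have h2 : (p.take n).length ≤ n := by simp
        exact_mod_cast h2
      · have h1 := p.adj_getVert_succ (i := n) (by omega)
        rwa [← hp, p.getVert_length] at h1
  · rintro ⟨z, hz, rfl | h⟩
    · exact le_trans (show g.edist 0 z ≤ n from hz) (by exact_mod_cast Nat.le_succ n)
    · refine (edist_le_add_one_of_adj h).trans ?_
      have hz' : g.edist 0 z ≤ n := hz
      push_cast
      gcongr

end Graph

/-! ### Growth of balls: the lower bound -/

section Box

variable {d : ℕ}

/-- The box of side length `N` with lowest corner `(N, …, N)`. -/
noncomputable def latticeBox (d N : ℕ) : Finset (Fin d → ℤ) :=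
  Fintype.piFinset fun _ => Finset.Ico (N : ℤ) (2 * N)

lemma card_latticeBox (d N : ℕ) : (latticeBox d N).card = N ^ d := by
  have : (2 * N - N : ℤ).toNat = N := by omega
  simp [latticeBox, Fintype.card_piFinset, this]

lemma le_latticeNorm_of_mem_latticeBox (hd : 1 ≤ d) {N : ℕ} {x : Fin d → ℤ}
    (hx : x ∈ latticeBox d N) : (N : ℝ) ≤ latticeNorm x := by
  have h := (Finset.mem_Ico.mp (Fintype.mem_piFinset.mp hx ⟨0, hd⟩)).1
  refine le_trans ?_ (abs_coord_le_latticeNorm x ⟨0, hd⟩)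
  refine le_trans ?_ (le_abs_self _)
  exact_mod_cast h

lemma latticeNorm_sub_le_of_mem_latticeBox {N N' : ℕ} (hN : N ≤ N') {x y : Fin d → ℤ}
    (hx : x ∈ latticeBox d N) (hy : y ∈ latticeBox d N') :
    latticeNorm (x - y) ≤ d * (2 * N') := by
  refine latticeNorm_le_of_abs_coord_le (by positivity) fun i => ?_
  have h1 := Finset.mem_Ico.mp (Fintype.mem_piFinset.mp hx i)
  have h2 := Finset.mem_Ico.mp (Fintype.mem_piFinset.mp hy i)
  have h3 : |(x - y) i| ≤ 2 * N' := by
    rw [Pi.sub_apply, abs_le]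
    constructor <;> omega
  exact_mod_cast h3

end Box

lemma summable_exp_mul_exp_neg_exp {B c ρ b : ℝ} (hc : 0 < c) (hρ : 0 < ρ) (hb : 1 < b) :
    Summable fun n : ℕ => Real.exp (B * b ^ n) * Real.exp (-(c * Real.exp (ρ * b ^ n))) := by
  have h1 : Summable fun n : ℕ => Real.exp (-(1 * b ^ n)) := by
    simpa using summable_pow_mul_exp_neg_pow one_pos one_pos hb
  refine h1.of_norm_bounded_eventually_nat ?_
  have h2 := (tendsto_exp_mul_div_rpow_atTop 1 ρ hρ).comp (tendsto_pow_atTop_atTop_of_one_lt hb)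
  filter_upwards [h2.eventually_ge_atTop ((B + 1) / c)] with n hn
  have hbn : 0 < b ^ n := by positivity
  simp only [Function.comp_apply, Real.rpow_one] at hn
  rw [div_le_div_iff₀ hc hbn] at hn
  rw [Real.norm_of_nonneg (by positivity), ← Real.exp_add]
  apply Real.exp_le_exp.mpr
  linarith

section Percolation

variable {d : ℕ} {α lam : ℝ} {ν : Measure ℝ} {Ω : Type*} [MeasurableSpace Ω] {P : Measure Ω}
  {W : (Fin d → ℤ) → Ω → ℝ} {G : Ω → SimpleGraph (Fin d → ℤ)}

namespace IsScaleFreePercolation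

lemma measure_forall_weight_le [IsProbabilityMeasure P] [IsProbabilityMeasure ν]
    (h : IsScaleFreePercolation α lam ν P W G) (Q : Finset (Fin d → ℤ)) (M : ℝ) :
    P {ω | ∀ x ∈ Q, W x ω ≤ M} ≤
      ENNReal.ofReal (Real.exp (-(Q.card * ν.real (Set.Ioi M)))) := by
  have h1 := h.weight_indep.measure_inter_preimage_eq_mul Q (sets := fun _ => Set.Iic M)
    fun _ _ => measurableSet_Iic
  have h2 : {ω | ∀ x ∈ Q, W x ω ≤ M} = ⋂ x ∈ Q, W x ⁻¹' Set.Iic M := by ext ω; simp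
  rw [h2, h1]
  have h3 : ∀ x, P (W x ⁻¹' Set.Iic M) ≤ ENNReal.ofReal (Real.exp (-ν.real (Set.Ioi M))) := by
    intro x
    rw [← Measure.map_apply (h.measurable_weight x) measurableSet_Iic, h.weight_law,
      ← ofReal_measureReal]
    apply ENNReal.ofReal_le_ofReal
    have h4 := probReal_compl_eq_one_sub (μ := ν) (measurableSet_Ioi (a := M))
    rw [Set.compl_Ioi] at h4
    rw [h4]
    linarith [Real.add_one_le_exp (-ν.real (Set.Ioi M))]
  calc ∏ x ∈ Q, P (W x ⁻¹' Set.Iic M)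
      ≤ ∏ _x ∈ Q, ENNReal.ofReal (Real.exp (-ν.real (Set.Ioi M))) :=
        Finset.prod_le_prod' fun x _ => h3 x
    _ = _ := by
      rw [Finset.prod_const, ← ENNReal.ofReal_pow (Real.exp_pos _).le, ← Real.exp_nat_mul]
      congr 2; ring

lemma ae_adj_of_norm_eq_one (h : IsScaleFreePercolation α lam ν P W G) :
    ∀ᵐ ω ∂P, ∀ x y, latticeNorm (x - y) = 1 → (G ω).Adj x y := by
  refine ae_all_iff.mpr fun x => ae_all_iff.mpr fun y => ?_
  by_cases hxy : latticeNorm (x - y) = 1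
  · filter_upwards [h.nearest_neighbour x y hxy] with ω hω _ using hω
  · exact ae_of_all _ fun ω h' => absurd h' hxy

/-- Two heavy vertices are unlikely not to be joined by an edge. -/
lemma measure_heavy_not_adj_le [IsProbabilityMeasure P]
    (h : IsScaleFreePercolation α lam ν P W G) (hlam : 0 ≤ lam) (hα : 0 ≤ α)
    {u v : Fin d → ℤ} (huv : u ≠ v) {M M' r : ℝ} (hM : 0 ≤ M) (hM' : 0 ≤ M')
    (hr : latticeNorm (u - v) ≤ r) :
    P {ω | M < W u ω ∧ M' < W v ω ∧ ¬ (G ω).Adj u v} ≤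
      ENNReal.ofReal (Real.exp (-(lam * (M * M' / r ^ α)))) := by
  have h1 := one_le_latticeNorm (sub_ne_zero.mpr huv)
  rcases h1.eq_or_lt with h1 | h1
  · refine le_of_eq_of_le (measure_mono_null (t := {ω | ¬ (G ω).Adj u v}) ?_ ?_) zero_le
    · exact fun ω hω => hω.2.2
    · exact h.nearest_neighbour u v h1.symm
  set S : Set ((Fin d → ℤ) → ℝ) := {w | M < w u ∧ M' < w v} with hS
  have hSm : MeasurableSet S := by
    have : S = (fun w => w u) ⁻¹' Set.Ioi M ∩ (fun w => w v) ⁻¹' Set.Ioi M' := rfl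
    rw [this]
    exact (measurable_pi_apply u measurableSet_Ioi).inter (measurable_pi_apply v measurableSet_Ioi)
  have key := h.measure_edges_inter ∅ {s(u, v)} (by simp) (by simp)
    (by simpa [edgeLength] using h1) hSm
  have hsub : {ω | M < W u ω ∧ M' < W v ω ∧ ¬ (G ω).Adj u v} ⊆
      {ω | (∀ e ∈ (∅ : Finset (Sym2 (Fin d → ℤ))), e ∈ (G ω).edgeSet) ∧
        ∀ e ∈ ({s(u, v)} : Finset (Sym2 (Fin d → ℤ))), e ∉ (G ω).edgeSet} ∩
      (fun ω x => W x ω) ⁻¹' S := by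
    rintro ω ⟨h2, h3, h4⟩
    exact ⟨⟨by simp, by simpa using h4⟩, h2, h3⟩
  refine (measure_mono hsub).trans (key.le.trans ?_)
  have hmS : MeasurableSet ((fun ω x => W x ω) ⁻¹' S) :=
    measurable_pi_iff.mpr h.measurable_weight hSm
  calc _ ≤ ∫⁻ _ω in (fun ω x => W x ω) ⁻¹' S,
        ENNReal.ofReal (Real.exp (-(lam * (M * M' / r ^ α)))) ∂P := by
        refine setLIntegral_mono' hmS fun ω hω => ENNReal.ofReal_le_ofReal ?_
        obtain ⟨h2, h3⟩ : M < W u ω ∧ M' < W v ω := hω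
        simp only [Finset.prod_empty, Finset.prod_singleton, one_mul, edgeProb, Sym2.lift_mk,
          sub_sub_cancel]
        apply Real.exp_le_exp.mpr
        have h5 : 0 < latticeNorm (u - v) := by linarith
        have h6 : 0 ≤ W u ω := hM.trans h2.le
        have h7 : 0 ≤ W v ω := hM'.trans h3.le
        gcongr
    _ ≤ _ := by
        rw [setLIntegral_const]
        exact mul_le_of_le_one_right' prob_le_one

/-- Boxes of doubly exponentially growing side length `exp (A b ^ i)` contain vertices heavier than
`exp (b ^ i)`, and heavy vertices in consecutive boxes are adjacent, for all large `i`. Starting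
from one of them, the balls grow doubly exponentially. -/
lemma ae_exists_far_vertex [IsProbabilityMeasure P] [IsProbabilityMeasure ν]
    (h : IsScaleFreePercolation α lam ν P W G) (hd : 1 ≤ d) (hlam : 0 < lam) {τ γ b : ℝ}
    (hα : 0 < α) (hτ : 1 < τ) (hpow : IsPowerLaw ν τ) (hγ : γ = α * (τ - 1) / d) (hb : 1 < b)
    (hγb : γ < 1 + 1 / b) :
    ∀ᵐ ω ∂P, ∃ c : ℝ, 0 < c ∧ ∀ᶠ n : ℕ in atTop, ∃ y ∈ graphBall (G ω) 0 n,
      Real.exp (c * b ^ n) ≤ latticeNorm y := by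
  have hd0 : (0 : ℝ) < d := by exact_mod_cast hd
  have hb0 : 0 < b := by linarith
  -- `A > (τ - 1) / d` provides heavy vertices in the boxes, `A < (1 + 1 / b) / α` makes the product
  -- of two consecutive weights exceed the distance to the power `α`
  obtain ⟨A, hA1, hA2⟩ : ∃ A, (τ - 1) / d < A ∧ A < (1 + 1 / b) / α := by
    refine exists_between ?_
    rw [lt_div_iff₀ hα]
    calc (τ - 1) / d * α = γ := by rw [hγ]; ring
      _ < _ := hγb
  have hA0 : 0 < A := lt_trans (div_pos (by linarith) hd0) hA1
  have hA1' : τ - 1 < A * d := (div_lt_iff₀ hd0).mp hA1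
  have hA2' : A * α < 1 + 1 / b := (lt_div_iff₀ hα).mp hA2
  obtain ⟨q, hq1, hq2⟩ := exists_between hA1'
  obtain ⟨c₁, hc₁, htail⟩ := hpow.exists_tail_ge (by linarith) hq1
  let M : ℕ → ℝ := fun i => Real.exp (b ^ i)
  let N : ℕ → ℕ := fun i => ⌈Real.exp (A * b ^ i)⌉₊
  have hNle : ∀ i, Real.exp (A * b ^ i) ≤ N i := fun i => Nat.le_ceil _
  have hNge : ∀ i, (N i : ℝ) ≤ 2 * Real.exp (A * b ^ i) := fun i => by
    have h1 := (Nat.ceil_lt_add_one (Real.exp_pos (A * b ^ i)).le).le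
    have h2 : 1 ≤ Real.exp (A * b ^ i) := Real.one_le_exp (by positivity)
    exact h1.trans (by linarith)
  have hNmono : ∀ i, N i ≤ N (i + 1) := fun i => by
    refine Nat.ceil_mono (Real.exp_le_exp.mpr ?_)
    gcongr
    · exact hb.le
    · omega
  let E : ℕ → Set Ω := fun i => {ω | ∀ x ∈ latticeBox d (N i), W x ω ≤ M i} ∪
    ⋃ u ∈ latticeBox d (N i), ⋃ v ∈ latticeBox d (N (i + 1)),
      {ω | u ≠ v ∧ M i < W u ω ∧ M (i + 1) < W v ω ∧ ¬ (G ω).Adj u v}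
  set c₂ : ℝ := lam / (4 * d) ^ α with hc₂
  have hc₂0 : 0 < c₂ := by positivity
  set ρ := 1 + 1 / b - A * α with hρ
  have hρ0 : 0 < ρ := by linarith
  let f : ℕ → ℝ := fun i => Real.exp (-(c₁ * Real.exp ((A * d - q) * b ^ i)))
  let f' : ℕ → ℝ := fun i => 4 ^ d * (Real.exp (2 * d * A * b ^ (i + 1)) *
    Real.exp (-(c₂ * Real.exp (ρ * b ^ (i + 1)))))
  have hf : Summable fun i => f i + f' i := by
    refine Summable.add ?_ (Summable.mul_left _ ?_)
    · simpa using summable_exp_mul_exp_neg_exp (B := 0) hc₁ (sub_pos.mpr hq2) hb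
    · exact (summable_nat_add_iff (f := fun i => Real.exp (2 * d * A * b ^ i) *
        Real.exp (-(c₂ * Real.exp (ρ * b ^ i)))) 1).mpr (summable_exp_mul_exp_neg_exp hc₂0 hρ0 hb)
  have hpair : ∀ i, ∀ u ∈ latticeBox d (N i), ∀ v ∈ latticeBox d (N (i + 1)),
      P {ω | u ≠ v ∧ M i < W u ω ∧ M (i + 1) < W v ω ∧ ¬ (G ω).Adj u v} ≤
        ENNReal.ofReal (Real.exp (-(c₂ * Real.exp (ρ * b ^ (i + 1))))) := by
    intro i u hu v hv
    by_cases huv : u = v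
    · simp [huv]
    have hr : latticeNorm (u - v) ≤ 4 * d * Real.exp (A * b ^ (i + 1)) := by
      refine (latticeNorm_sub_le_of_mem_latticeBox (hNmono i) hu hv).trans ?_
      calc (d : ℝ) * (2 * N (i + 1)) ≤ d * (2 * (2 * Real.exp (A * b ^ (i + 1)))) := by
            gcongr; exact hNge _
        _ = _ := by ring
    refine le_trans (measure_mono fun ω hω => hω.2) ((h.measure_heavy_not_adj_le hlam.le hα.le huv
      (Real.exp_pos _).le (Real.exp_pos _).le hr).trans (le_of_eq ?_))
    congr 3
    rw [Real.mul_rpow (by positivity) (Real.exp_pos _).le, ← Real.exp_mul, hc₂, ← Real.exp_add,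
      mul_comm (_ ^ α) (Real.exp _), ← div_div, ← Real.exp_sub, hρ]
    have e : b ^ i + b ^ (i + 1) - A * b ^ (i + 1) * α = (1 + 1 / b - A * α) * b ^ (i + 1) := by
      field_simp
      ring
    rw [e]
    ring
  have hE : ∀ᶠ i : ℕ in atTop, P (E i) ≤ ENNReal.ofReal (f i + f' i) := by
    have hexp : Tendsto (fun i : ℕ => Real.exp (b ^ i)) atTop atTop :=
      Real.tendsto_exp_atTop.comp (tendsto_pow_atTop_atTop_of_one_lt hb)
    filter_upwards [hexp.eventually htail] with i hi
    rw [ENNReal.ofReal_add (by positivity) (by positivity)]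
    refine (measure_union_le _ _).trans (add_le_add ?_ ?_)
    · refine (h.measure_forall_weight_le _ _).trans (ENNReal.ofReal_le_ofReal ?_)
      apply Real.exp_le_exp.mpr
      rw [neg_le_neg_iff, card_latticeBox]
      push_cast
      calc c₁ * Real.exp ((A * d - q) * b ^ i)
          = Real.exp (A * b ^ i) ^ d * (c₁ * Real.exp (b ^ i) ^ (-q)) := by
            rw [← Real.exp_mul, ← Real.exp_nat_mul, mul_left_comm, ← Real.exp_add]
            congr 2; ring
        _ ≤ (N i : ℝ) ^ d * ν.real (Set.Ioi (M i)) := by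
            gcongr
            exact hNle i
    · calc P (⋃ u ∈ latticeBox d (N i), ⋃ v ∈ latticeBox d (N (i + 1)),
            {ω | u ≠ v ∧ M i < W u ω ∧ M (i + 1) < W v ω ∧ ¬ (G ω).Adj u v})
          ≤ ∑ _u ∈ latticeBox d (N i), ∑ _v ∈ latticeBox d (N (i + 1)),
            ENNReal.ofReal (Real.exp (-(c₂ * Real.exp (ρ * b ^ (i + 1))))) := by
            refine (measure_biUnion_finset_le _ _).trans (Finset.sum_le_sum fun u hu => ?_)
            exact (measure_biUnion_finset_le _ _).trans
              (Finset.sum_le_sum fun v hv => hpair i u hu v hv)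
        _ = ENNReal.ofReal ((N i : ℝ) ^ d * ((N (i + 1) : ℝ) ^ d *
            Real.exp (-(c₂ * Real.exp (ρ * b ^ (i + 1)))))) := by
            rw [Finset.sum_const, Finset.sum_const, card_latticeBox, card_latticeBox,
              nsmul_eq_mul, nsmul_eq_mul, ENNReal.ofReal_mul (by positivity),
              ENNReal.ofReal_mul (by positivity), ← ENNReal.ofReal_natCast,
              ← ENNReal.ofReal_natCast]
            push_cast
            rfl
        _ ≤ ENNReal.ofReal (f' i) := by
            apply ENNReal.ofReal_le_ofReal
            have h1 : (N i : ℝ) ≤ 2 * Real.exp (A * b ^ (i + 1)) :=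
              (Nat.cast_le.mpr (hNmono i)).trans (hNge _)
            calc _ ≤ (2 * Real.exp (A * b ^ (i + 1))) ^ d * ((2 * Real.exp (A * b ^ (i + 1))) ^ d *
                Real.exp (-(c₂ * Real.exp (ρ * b ^ (i + 1))))) := by
                  gcongr
                  exact hNge _
              _ = f' i := by
                  have e : Real.exp (2 * d * A * b ^ (i + 1)) =
                      Real.exp (A * b ^ (i + 1)) ^ d * Real.exp (A * b ^ (i + 1)) ^ d := by
                    rw [← Real.exp_nat_mul, ← Real.exp_add]
                    congr 1; ring
                  simp only [f']
                  rw [e, show (4 : ℝ) = 2 * 2 by norm_num]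
                  simp only [mul_pow]
                  ring
  have hsum : ∑' i, P (E i) ≠ ⊤ := by
    have h1 : Summable fun i => P.real (E i) := by
      refine hf.of_norm_bounded_eventually_nat ?_
      filter_upwards [hE] with i hi
      rw [Real.norm_of_nonneg measureReal_nonneg]
      exact ENNReal.toReal_le_of_le_ofReal (by positivity) hi
    exact ne_of_eq_of_ne (tsum_congr fun i => (ofReal_measureReal).symm) h1.tsum_ofReal_ne_top
  filter_upwards [ae_eventually_notMem hsum, h.ae_adj_of_norm_eq_one] with ω hω hnn
  obtain ⟨i₀, hi₀⟩ := eventually_atTop.mp hω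
  have hheavy : ∀ m, ∃ x ∈ latticeBox d (N (i₀ + m)), M (i₀ + m) < W x ω := by
    intro m
    by_contra! hcon
    exact hi₀ (i₀ + m) (by omega) (Or.inl hcon)
  choose y hyQ hyW using hheavy
  have hadj : ∀ m, y m = y (m + 1) ∨ (G ω).Adj (y m) (y (m + 1)) := by
    intro m
    by_contra! hcon
    refine hi₀ (i₀ + m) (by omega) (Or.inr ?_)
    simp only [Set.mem_iUnion]
    exact ⟨y m, hyQ m, y (m + 1), hyQ (m + 1), hcon.1, hyW m, hyW (m + 1), hcon.2⟩
  obtain ⟨p⟩ := reachable_of_nearest_neighbour hnn (y 0)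
  have hball : ∀ m, y m ∈ graphBall (G ω) 0 (p.length + m) := by
    intro m
    induction m with
    | zero => exact SimpleGraph.edist_le p
    | succ m ih => exact (mem_graphBall_succ_iff _ _).mpr ⟨y m, ih, hadj m⟩
  refine ⟨A * b ^ i₀ / b ^ p.length, by positivity, ?_⟩
  filter_upwards [eventually_ge_atTop p.length] with n hn
  obtain ⟨m, rfl⟩ := Nat.exists_eq_add_of_le hn
  refine ⟨y m, hball m, ?_⟩
  calc Real.exp (A * b ^ i₀ / b ^ p.length * b ^ (p.length + m))
      = Real.exp (A * b ^ (i₀ + m)) := by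
        congr 1
        rw [pow_add, pow_add]
        field_simp
    _ ≤ N (i₀ + m) := hNle _
    _ ≤ latticeNorm (y m) := le_latticeNorm_of_mem_latticeBox hd (hyQ m)

end IsScaleFreePercolation

end Percolation

/-! ### Random prefactors -/

/-- If the exceptional events `B K` have exponentially small probability, then almost surely some
random level `Y` with exponential tails is not exceptional. Only natural levels are used, and the
exceptional events are replaced by measurable supersets of the same measure. -/
lemma exists_random_level {Ω : Type*} [MeasurableSpace Ω] (P : Measure Ω) [IsProbabilityMeasure P]
    {B : ℝ → Set Ω} {C a : ℝ} (hC : 0 < C) (ha : 0 < a)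
    (hB : ∀ K, 1 ≤ K → P (B K) ≤ ENNReal.ofReal (C * Real.exp (-(a * K)))) :
    ∃ Y : Ω → ℝ, Measurable Y ∧ (∀ᵐ ω ∂P, ω ∉ B (Y ω)) ∧
      ∀ K : ℝ, P.real {ω | K ≤ Y ω} ≤ (C + 1) * Real.exp a * Real.exp (-(a * K)) := by
  classical
  let T : ℕ → Set Ω := fun k => toMeasurable P (B (k + 1))
  have hT : ∀ k, MeasurableSet (T k) := fun k => measurableSet_toMeasurable _ _
  have hPT : ∀ k : ℕ, P (T k) ≤ ENNReal.ofReal (C * Real.exp (-(a * (k + 1)))) := fun k => by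
    rw [measure_toMeasurable]
    exact hB _ (by linarith [(Nat.cast_nonneg k : (0 : ℝ) ≤ k)])
  have hnull : P (⋂ k, T k) = 0 := by
    have h1 : Tendsto (fun k : ℕ => ENNReal.ofReal (C * Real.exp (-(a * (k + 1))))) atTop (𝓝 0) := by
      rw [← ENNReal.ofReal_zero]
      refine ENNReal.tendsto_ofReal ?_
      rw [← mul_zero C]
      refine Tendsto.const_mul C (Real.tendsto_exp_neg_atTop_nhds_zero.comp ?_)
      exact (tendsto_natCast_atTop_atTop.atTop_add tendsto_const_nhds).const_mul_atTop ha
    exact le_antisymm (ge_of_tendsto' h1 fun k => (measure_mono (Set.iInter_subset _ k)).trans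
      (hPT k)) zero_le
  have hex : ∀ ω, ∃ k, ω ∉ T k ∨ ω ∈ ⋂ k, T k := by
    intro ω
    by_cases h : ω ∈ ⋂ k, T k
    · exact ⟨0, Or.inr h⟩
    · obtain ⟨k, hk⟩ := not_forall.mp (fun h' => h (Set.mem_iInter.mpr h'))
      exact ⟨k, Or.inl hk⟩
  have hmeas : Measurable fun ω => Nat.find (hex ω) :=
    measurable_find hex fun k => (hT k).compl.union (MeasurableSet.iInter hT)
  refine ⟨fun ω => (Nat.find (hex ω) : ℝ) + 1, ?_, ?_, ?_⟩
  · exact (measurable_from_top.comp hmeas).add_const 1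
  · filter_upwards [measure_eq_zero_iff_ae_notMem.mp hnull] with ω hω hmem
    rcases Nat.find_spec (hex ω) with h | h
    · exact h (subset_toMeasurable _ _ hmem)
    · exact hω h
  · intro K
    have hC1 : 1 ≤ C + 1 := by linarith
    rw [mul_assoc, ← Real.exp_add]
    rcases le_or_gt K 1 with hK | hK
    · refine measureReal_le_one.trans (one_le_mul_of_one_le_of_one_le hC1 (Real.one_le_exp ?_))
      nlinarith
    · set m := ⌈K⌉₊ with hm
      have hm1 : 1 < m := Nat.lt_ceil.mpr (by simpa using hK)
      obtain ⟨k, hk⟩ : ∃ k, m = k + 2 := ⟨m - 2, by omega⟩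
      have hsub : {ω | K ≤ (Nat.find (hex ω) : ℝ) + 1} ⊆ T k := by
        intro ω hω
        have h1 : m ≤ Nat.find (hex ω) + 1 := Nat.ceil_le.mpr (by exact_mod_cast hω)
        have h2 := Nat.find_min (hex ω) (m := k) (by omega)
        exact not_not.mp fun h => h2 (Or.inl h)
      have h1 : P.real (T k) ≤ C * Real.exp (-(a * (k + 1))) :=
        ENNReal.toReal_le_of_le_ofReal (by positivity) (hPT k)
      have hKm : K ≤ k + 2 := by
        have := Nat.le_ceil K
        rw [← hm, hk] at this
        exact_mod_cast this
      calc P.real {ω | K ≤ (Nat.find (hex ω) : ℝ) + 1} ≤ P.real (T k) := measureReal_mono hsub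
        _ ≤ C * Real.exp (-(a * (k + 1))) := h1
        _ ≤ (C + 1) * Real.exp (a + -(a * K)) := by
          gcongr
          · linarith
          · nlinarith

/-- Measurable selection of an index: the first `j` with `ω ∈ T j` is measurable in `ω`. -/
lemma exists_measurable_index {Ω : Type*} [MeasurableSpace Ω] {P : Measure Ω} {T : ℕ → Set Ω}
    (hT : ∀ j, MeasurableSet (T j)) (h : ∀ᵐ ω ∂P, ∃ j, ω ∈ T j) :
    ∃ J : Ω → ℕ, Measurable J ∧ ∀ᵐ ω ∂P, ω ∈ T (J ω) := by
  classical
  have hex : ∀ ω, ∃ j, ω ∈ T j ∨ ω ∉ ⋃ j, T j := by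
    intro ω
    by_cases hω : ω ∈ ⋃ j, T j
    · obtain ⟨j, hj⟩ := Set.mem_iUnion.mp hω
      exact ⟨j, Or.inl hj⟩
    · exact ⟨0, Or.inr hω⟩
  refine ⟨fun ω => Nat.find (hex ω),
    measurable_find hex fun j => (hT j).union (MeasurableSet.iUnion hT).compl, ?_⟩
  filter_upwards [h] with ω hω
  rcases Nat.find_spec (hex ω) with h1 | h1
  · exact h1
  · exact absurd (Set.mem_iUnion.mpr hω) h1

section Percolation

variable {d : ℕ} {α lam : ℝ} {ν : Measure ℝ} {Ω : Type*} [MeasurableSpace Ω] {P : Measure Ω}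
  {W : (Fin d → ℤ) → Ω → ℝ} {G : Ω → SimpleGraph (Fin d → ℤ)}

lemma IsScaleFreePercolation.measurableSet_mem_graphBall (h : IsScaleFreePercolation α lam ν P W G)
    (n : ℕ) (y : Fin d → ℤ) : MeasurableSet {ω | y ∈ graphBall (G ω) 0 n} := by
  induction n generalizing y with
  | zero =>
    have : {ω | y ∈ graphBall (G ω) 0 0} = {_ω | (0 : Fin d → ℤ) = y} := by
      ext ω
      change (G ω).edist 0 y ≤ ((0 : ℕ) : ℕ∞) ↔ 0 = y
      rw [Nat.cast_zero, nonpos_iff_eq_zero, SimpleGraph.edist_eq_zero_iff]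
    rw [this]
    exact MeasurableSet.const _
  | succ n ih =>
    have : {ω | y ∈ graphBall (G ω) 0 (n + 1)} =
        ⋃ z, {ω | z ∈ graphBall (G ω) 0 n} ∩ ({_ω | z = y} ∪ {ω | (G ω).Adj z y}) := by
      ext ω
      simp [mem_graphBall_succ_iff]
    rw [this]
    exact MeasurableSet.iUnion fun z =>
      (ih z).inter ((MeasurableSet.const _).union (h.measurable_adj z y))

/-- Lower bound for a fixed graph, in terms of the balls. The finitely many radii not covered by
the asymptotic growth are absorbed into the prefactor `1 / (j + 1)`. -/
lemma exists_rate_of_eventually_far {g : SimpleGraph (Fin d → ℤ)} (hd : 1 ≤ d)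
    (hg : ∀ x y, latticeNorm (x - y) = 1 → g.Adj x y) {b : ℝ} (hb : 0 < b)
    (hfar : 1 < b → ∃ c : ℝ, 0 < c ∧ ∀ᶠ n : ℕ in atTop, ∃ y ∈ graphBall g 0 n,
      Real.exp (c * b ^ n) ≤ latticeNorm y) :
    ∃ j : ℕ, ∀ n : ℕ, 1 ≤ n → (2 ≤ n ∨ ∃ y ∈ graphBall g 0 n, 1 < latticeNorm y) →
      ∃ y ∈ graphBall g 0 n, Real.exp (1 / ((j : ℝ) + 1) * b ^ n) ≤ latticeNorm y := by
  have htwo : ∀ n, 2 ≤ n → ∃ y ∈ graphBall g 0 n, latticeNorm y = 2 := by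
    intro n hn
    refine ⟨Pi.single ⟨0, hd⟩ 1 + Pi.single ⟨0, hd⟩ 1, ?_, ?_⟩
    · have h1 : g.Adj 0 (Pi.single ⟨0, hd⟩ 1) := by
        simpa using adj_add_single hg 0 ⟨0, hd⟩ (t := 1) (by simp)
      have h2 := adj_add_single hg (Pi.single ⟨0, hd⟩ 1) ⟨0, hd⟩ (t := 1) (by simp)
      have h3 := SimpleGraph.edist_le ((SimpleGraph.Walk.nil.cons h2).cons h1)
      refine le_trans h3 ?_
      simpa using (by exact_mod_cast hn : ((2 : ℕ) : ℕ∞) ≤ n)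
    · rw [← Pi.single_add, latticeNorm_single]
      norm_num
  have hfar' : ∃ c : ℝ, 0 < c ∧ ∀ᶠ n : ℕ in atTop, ∃ y ∈ graphBall g 0 n,
      Real.exp (c * b ^ n) ≤ latticeNorm y := by
    rcases lt_or_ge 1 b with h1 | h1
    · exact hfar h1
    · refine ⟨Real.log 2, Real.log_pos one_lt_two, ?_⟩
      filter_upwards [eventually_ge_atTop 2] with n hn
      obtain ⟨y, hy, hy2⟩ := htwo n hn
      refine ⟨y, hy, ?_⟩
      rw [hy2, ← Real.le_log_iff_exp_le two_pos]
      exact mul_le_of_le_one_right (Real.log_pos one_lt_two).le (pow_le_one₀ hb.le h1)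
  obtain ⟨c, hc, hev⟩ := hfar'
  obtain ⟨N, hN⟩ := eventually_atTop.mp hev
  have hlim : Tendsto (fun j : ℕ => 1 / ((j : ℝ) + 1)) atTop (𝓝 0) :=
    tendsto_one_div_add_atTop_nhds_zero_nat
  have hsmall : ∀ n : ℕ, ∀ᶠ j : ℕ in atTop,
      (2 ≤ n ∨ ∃ y ∈ graphBall g 0 n, 1 < latticeNorm y) →
      ∃ y ∈ graphBall g 0 n, Real.exp (1 / ((j : ℝ) + 1) * b ^ n) ≤ latticeNorm y := by
    intro n
    by_cases hn : 2 ≤ n ∨ ∃ y ∈ graphBall g 0 n, 1 < latticeNorm y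
    · obtain ⟨y, hy, hy1⟩ : ∃ y ∈ graphBall g 0 n, 1 < latticeNorm y := by
        rcases hn with hn | hn
        · obtain ⟨y, hy, hy2⟩ := htwo n hn
          exact ⟨y, hy, by rw [hy2]; exact one_lt_two⟩
        · exact hn
      have h1 : Tendsto (fun j : ℕ => 1 / ((j : ℝ) + 1) * b ^ n) atTop (𝓝 0) := by
        simpa using hlim.mul_const (b ^ n)
      filter_upwards [h1.eventually (gt_mem_nhds (Real.log_pos hy1))] with j hj _
      exact ⟨y, hy, (Real.le_log_iff_exp_le (by linarith)).mp hj.le⟩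
    · exact Eventually.of_forall fun j h => absurd h hn
  have hall := (eventually_all_finset (Finset.range N)).mpr fun n _ => hsmall n
  obtain ⟨j, hj, hjc⟩ := (hall.and (hlim.eventually (gt_mem_nhds hc))).exists
  refine ⟨j, fun n _ hn => ?_⟩
  rcases lt_or_ge n N with h1 | h1
  · exact hj n (Finset.mem_range.mpr h1) hn
  · obtain ⟨y, hy, hyn⟩ := hN n h1
    refine ⟨y, hy, le_trans (Real.exp_le_exp.mpr ?_) hyn⟩
    gcongr

end Percolation

/-! ### Growth of balls and maximal displacement -/

theorem mainTheorem3 (d : ℕ) (hd : 1 ≤ d) (α τ γ : ℝ) (hα : (d : ℝ) < α) (hτ : 1 < τ)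
    (hγ : γ = α * (τ - 1) / d) (hγ1 : 1 < γ) (hγ2 : γ < 2) :
    -- the constant `c` depends only on `d`, `α`, `τ`
    ∃ c : ℝ, 0 < c ∧
    ∀ (lam : ℝ) (ν : Measure ℝ) [IsProbabilityMeasure ν], 0 < lam → IsPowerLaw ν τ →
      ν (Set.Ici 1) = 1 →
    -- the constants `C ε` depend only on `ε` and on the parameters of the model
    ∃ C : ℝ → ℝ, (∀ ε, 0 < C ε) ∧
    ∀ {Ω : Type*} [MeasurableSpace Ω] (P : Measure Ω) [IsProbabilityMeasure P]
      (W : (Fin d → ℤ) → Ω → ℝ) (G : Ω → SimpleGraph (Fin d → ℤ)),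
      IsScaleFreePercolation α lam ν P W G →
    -- the maximum in the definition of the maximal displacement is attained
    (∀ᵐ ω ∂P, ∀ n : ℕ,
      IsGreatest (latticeNorm '' graphSphere (G ω) 0 n) (maxDisplacement (G ω) n)) ∧
    -- lower bound
    (∀ ε : ℝ, 0 < ε → ε < 1 → ∃ Z : Ω → ℝ, Measurable Z ∧ (∀ ω, 0 < Z ω ∧ Z ω ≤ 2) ∧
      ∀ᵐ ω ∂P, ∀ n : ℕ, 1 ≤ n → (2 ≤ n ∨ 1 < maxDisplacement (G ω) n) →
        Real.exp (Z ω * ((1 - ε) / (γ - 1)) ^ n) ≤ maxDisplacement (G ω) n) ∧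
    -- upper bound, inclusion of balls, and tail of the prefactor
    (∀ ε : ℝ, 0 < ε → ∃ Y : Ω → ℝ, Measurable Y ∧
      (∀ᵐ ω ∂P, ∀ n : ℕ, 1 ≤ n →
        maxDisplacement (G ω) n ≤ Real.exp (Y ω * ((1 + ε) / (γ - 1)) ^ n)) ∧
      (∀ᵐ ω ∂P, ∀ n : ℕ,
        graphBall (G ω) 0 n ⊆ euclideanBall 0 (Real.exp (Y ω * ((1 + ε) / (γ - 1)) ^ n))) ∧
      ∀ K : ℝ, P.real {ω | K ≤ Y ω} ≤ C ε * Real.exp (-(c * ε * K))) := by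
  have hα0 : 0 < α := (Nat.cast_nonneg d).trans_lt hα
  have hγ1' : 0 < γ - 1 := by linarith
  obtain ⟨c, A, hc, hA, htail⟩ := exists_ball_growth_tail d hd α τ γ hα hγ hγ1 hγ2
  refine ⟨c / A, by positivity, ?_⟩
  intro lam ν _ hlam hpow hν1
  have htail' : ∀ ε : ℝ, ∃ C : ℝ, 0 < C ∧ (0 < ε →
      ∀ {Ω : Type _} [MeasurableSpace Ω] (P : Measure Ω) [IsProbabilityMeasure P]
        (W : (Fin d → ℤ) → Ω → ℝ) (G : Ω → SimpleGraph (Fin d → ℤ)),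
        IsScaleFreePercolation α lam ν P W G → ∀ K : ℝ, 1 ≤ K →
        P {ω | ¬ ∀ n : ℕ, ∀ y ∈ graphBall (G ω) 0 n,
          latticeNorm y ≤ Real.exp (A * K * ((1 + ε) / (γ - 1)) ^ n)} ≤
        ENNReal.ofReal (C * Real.exp (-(c * ε * K)))) := by
    intro ε
    by_cases hε : 0 < ε
    · obtain ⟨C, hC, hC'⟩ := htail lam ν hlam hpow hν1 ε hε
      exact ⟨C, hC, fun _ => hC'⟩
    · exact ⟨1, one_pos, fun h => absurd h hε⟩
  choose C hC hCtail using htail'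
  refine ⟨fun ε => (C ε + 1) * Real.exp (c * ε),
    fun ε => mul_pos (by linarith [hC ε]) (Real.exp_pos _), ?_⟩
  intro Ω _ P _ W G h
  have hprefactor : ∀ ε : ℝ, 0 < ε → ∃ Y : Ω → ℝ, Measurable Y ∧
      (∀ᵐ ω ∂P, ∀ n : ℕ, ∀ y ∈ graphBall (G ω) 0 n,
        latticeNorm y ≤ Real.exp (Y ω * ((1 + ε) / (γ - 1)) ^ n)) ∧
      ∀ K : ℝ, P.real {ω | K ≤ Y ω} ≤
        (C ε + 1) * Real.exp (c * ε) * Real.exp (-(c / A * ε * K)) := by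
    intro ε hε
    obtain ⟨Y, hYm, hY, hYtail⟩ := exists_random_level P (hC ε) (by positivity : 0 < c * ε)
      (hCtail ε hε P W G h)
    refine ⟨fun ω => A * Y ω, hYm.const_mul A, ?_, fun K => ?_⟩
    · filter_upwards [hY] with ω hω
      exact not_not.mp hω
    · have h1 : {ω | K ≤ A * Y ω} = {ω | K / A ≤ Y ω} := by
        ext ω
        exact (div_le_iff₀' hA).symm
      rw [h1, show c / A * ε * K = c * ε * (K / A) by ring]
      exact hYtail _
  have hnn := h.ae_adj_of_norm_eq_one
  have hbdd : ∀ᵐ ω ∂P, ∃ R : ℕ → ℝ, ∀ n, ∀ y ∈ graphBall (G ω) 0 n, latticeNorm y ≤ R n := by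
    obtain ⟨Y, -, hY, -⟩ := hprefactor 1 one_pos
    filter_upwards [hY] with ω hω
    exact ⟨_, hω⟩
  have hmax : ∀ᵐ ω ∂P, ∀ n : ℕ,
      IsGreatest (latticeNorm '' graphSphere (G ω) 0 n) (maxDisplacement (G ω) n) := by
    filter_upwards [hnn, hbdd] with ω hω ⟨R, hR⟩ n
    exact isGreatest_maxDisplacement hd hω (hR n)
  refine ⟨hmax, fun ε hε0 hε1 => ?_, fun ε hε => ?_⟩
  · set b := (1 - ε) / (γ - 1) with hb
    have hb0 : 0 < b := div_pos (by linarith) hγ1'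
    have hγb : γ < 1 + 1 / b := by
      rw [hb, one_div_div, ← sub_lt_iff_lt_add', lt_div_iff₀ (by linarith)]
      nlinarith
    -- the lower bound with prefactor `1 / (j + 1)`, phrased through the balls to be measurable
    let T : ℕ → Set Ω := fun j => {ω | ∀ n : ℕ, 1 ≤ n →
      (2 ≤ n ∨ ∃ y ∈ graphBall (G ω) 0 n, 1 < latticeNorm y) →
      ∃ y ∈ graphBall (G ω) 0 n, Real.exp (1 / ((j : ℝ) + 1) * b ^ n) ≤ latticeNorm y}
    have hex : ∀ (n : ℕ) (p : (Fin d → ℤ) → Prop),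
        MeasurableSet {ω | ∃ y ∈ graphBall (G ω) 0 n, p y} := by
      intro n p
      have : {ω | ∃ y ∈ graphBall (G ω) 0 n, p y} =
          ⋃ y, {ω | y ∈ graphBall (G ω) 0 n} ∩ {_ω | p y} := by
        ext ω; simp
      rw [this]
      exact MeasurableSet.iUnion fun y =>
        (h.measurableSet_mem_graphBall n y).inter (MeasurableSet.const _)
    have hTm : ∀ j, MeasurableSet (T j) := fun j =>
      measurableSet_setOfPred.mpr <| Measurable.forall fun n =>
        measurable_const.imp <| Measurable.imp
          (measurable_const.or (measurableSet_setOfPred.mp (hex n _)))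
          (measurableSet_setOfPred.mp (hex n _))
    have hT : ∀ᵐ ω ∂P, ∃ j, ω ∈ T j := by
      have hfar : ∀ᵐ ω ∂P, 1 < b → ∃ c : ℝ, 0 < c ∧ ∀ᶠ n : ℕ in atTop,
          ∃ y ∈ graphBall (G ω) 0 n, Real.exp (c * b ^ n) ≤ latticeNorm y := by
        by_cases hb1 : 1 < b
        · filter_upwards [h.ae_exists_far_vertex hd hlam hα0 hτ hpow hγ hb1 hγb] with ω hω _ using hω
        · exact ae_of_all _ fun ω h' => absurd h' hb1
      filter_upwards [hnn, hfar] with ω hω hω'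
      exact exists_rate_of_eventually_far hd hω hb0 hω'
    obtain ⟨J, hJm, hJ⟩ := exists_measurable_index hTm hT
    refine ⟨fun ω => 1 / ((J ω : ℝ) + 1), ?_, fun ω => ⟨by positivity, ?_⟩, ?_⟩
    · exact (measurable_from_top (f := fun j : ℕ => 1 / ((j : ℝ) + 1))).comp hJm
    · refine le_trans ?_ one_le_two
      rw [div_le_one (by positivity)]
      linarith [(Nat.cast_nonneg (J ω) : (0 : ℝ) ≤ J ω)]
    · filter_upwards [hJ, hnn, hbdd, hmax] with ω hω hω' ⟨R, hR⟩ hm n hn1 hn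
      obtain ⟨y, hy, hyn⟩ := hω n hn1 (hn.imp_right fun h1 => by
        obtain ⟨z, hz, hzm⟩ := (hm n).1
        exact ⟨z, hz.1, by rwa [hzm]⟩)
      exact hyn.trans (le_maxDisplacement hd hω' (hR n) hy)
  · obtain ⟨Y, hYm, hY, hYtail⟩ := hprefactor ε hε
    refine ⟨Y, hYm, ?_, ?_, hYtail⟩
    · filter_upwards [hY, hmax] with ω hω hm n _
      obtain ⟨z, hz, hzm⟩ := (hm n).1
      rw [← hzm]
      exact hω n z hz.1
    · filter_upwards [hY] with ω hω n y hy
      have h1 := hω n y hy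
      rwa [← latticeNorm_neg, ← zero_sub] at h1
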